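/- Let $(\Omega_n,P_n,\pi_n)_{n\in\mathbb N}$ be a sequence of finite irreducible reversible Markov chains, with transition matrices $P_n$ and stationary distributions $\pi_n$. For such a chain $(\Omega,P,\pi)$ put $$H_t:=\sum_{k\ge 0}\frac{e^{-t}t^k}{k!}P^k\quad(t\in[0,\infty)),\qquad A_t:=\tfrac12\left(P^t+P^{t+1}\right)\quad(t\in\mathbb Z_{\ge 0}),$$ $$d_{\mathrm c}(t):=\max_{x\in\Omega}\|H_t(x,\cdot)-\pi\|_{\mathrm{TV}},\qquad d_{\mathrm{ave}}(t):=\max_{x\in\Omega}\|A_t(x,\cdot)-\pi\|_{\mathrm{TV}},$$ where $\|\mu-\nu\|_{\mathrm{TV}}:=\frac12\sum_{x}|\mu(x)-\nu(x)|$, and for $0<\epsilon<1$ let $$t_{\mathrm c}(\epsilon):=\inf\{t\in[0,\infty): d_{\mathrm c}(t)\le\epsilon\},\qquad t_{\mathrm{ave}}(\epsilon):=\inf\{t\in\mathbb Z_{\ge 0}: d_{\mathrm{ave}}(t)\le\epsilon\}.$$ Write $t_{\mathrm c}^{(n)}(\epsilon)$, $t_{\mathrm{ave}}^{(n)}(\epsilon)$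 for the mixing times of the $n$-th chain, and $t_{\mathrm c}^{(n)}:=t_{\mathrm c}^{(n)}(1/4)$, $t_{\mathrm{ave}}^{(n)}:=t_{\mathrm{ave}}^{(n)}(1/4)$. For a sequence of reals $(w_n)$, the sequence of chains is said to exhibit a continuous-time (respectively, averaged) cutoff with window $w_n$ if $w_n=o(t_{\mathrm c}^{(n)})$ (respectively, $w_n=o(t_{\mathrm{ave}}^{(n)})$) as $n\to\infty$, and for every $0<\epsilon\le 1/4$ there is a constant $C_\epsilon>0$, not depending on $n$, such that for all $n$ $$t_{\mathrm c}^{(n)}(\epsilon)-t_{\mathrm c}^{(n)}(1-\epsilon)\le C_\epsilon w_n\qquad\left(\text{respectively, } t_{\mathrm{ave}}^{(n)}(\epsilon)-t_{\mathrm{ave}}^{(n)}(1-\epsilon)\le C_\epsilon w_n\right).$$ Here $a_n=o(b_n)$ means that for every $\delta>0$, $|a_n|\le\delta|b_n|$ for all sufficiently large $n$. (i) If the sequence exhibits a continuous-time cutoff with window $w_n$, then it exhibits an averaged cutoff with window $w_n$. (ii) If $t_{\mathrm{ave}}^{(n)}>0$ for all sufficiently large $n$ and the sequence exhibits an averaged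 cutoff with window $w_n$, then it exhibits a continuous-time cutoff with window $\max\{w_n,\sqrt{t_{\mathrm c}^{(n)}}\}$. -/

import Mathlib

open Filter Asymptotics

noncomputable section

/-- `(Ω, P, π)` is a finite irreducible reversible Markov chain with transition matrix `P` and
stationary distribution `π` (stationarity follows from the detailed balance equations). -/
structure IsReversibleChain {Ω : Type*} [Fintype Ω] [DecidableEq Ω]
    (P : Matrix Ω Ω ℝ) (π : Ω → ℝ) : Prop where
  stochastic : P ∈ Matrix.rowStochastic ℝ Ω
  irreducible : P.IsIrreducible
  distribution : π ∈ stdSimplex ℝ Ω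
  detailed_balance : ∀ x y, π x * P x y = π y * P y x

/-- Total-variation distance of two distributions on a finite set. -/
def tvDist {Ω : Type*} [Fintype Ω] (μ ν : Ω → ℝ) : ℝ :=
  (1 / 2) * ∑ x, |μ x - ν x|

/-- The heat kernel `H_t = ∑ₖ e^{-t} t^k / k! P^k` of the continuous-time chain. -/
def heatKernel {Ω : Type*} [Fintype Ω] [DecidableEq Ω] (P : Matrix Ω Ω ℝ) (t : ℝ) :
    Matrix Ω Ω ℝ :=
  fun x y => ∑' k : ℕ, Real.exp (-t) * t ^ k / (k.factorial : ℝ) * (P ^ k) x y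

/-- The kernel `A_t = (P^t + P^{t+1}) / 2` of the averaged chain. -/
def averagedKernel {Ω : Type*} [Fintype Ω] [DecidableEq Ω] (P : Matrix Ω Ω ℝ) (t : ℕ) :
    Matrix Ω Ω ℝ :=
  fun x y => ((P ^ t) x y + (P ^ (t + 1)) x y) / 2

/-- Worst-case distance to stationarity at time `t` of the continuous-time chain. The supremum is
over a finite set, hence a maximum. -/
def dCont {Ω : Type*} [Fintype Ω] [DecidableEq Ω] (P : Matrix Ω Ω ℝ) (π : Ω → ℝ) (t : ℝ) : ℝ :=
  ⨆ x, tvDist (heatKernel P t x) π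

/-- Worst-case distance to stationarity at time `t` of the averaged chain. -/
def dAve {Ω : Type*} [Fintype Ω] [DecidableEq Ω] (P : Matrix Ω Ω ℝ) (π : Ω → ℝ) (t : ℕ) : ℝ :=
  ⨆ x, tvDist (averagedKernel P t x) π

/-- The `ε`-mixing-time of the continuous-time chain. -/
def tCont {Ω : Type*} [Fintype Ω] [DecidableEq Ω] (P : Matrix Ω Ω ℝ) (π : Ω → ℝ) (ε : ℝ) : ℝ :=
  sInf {t : ℝ | 0 ≤ t ∧ dCont P π t ≤ ε}

/-- The `ε`-mixing-time of the averaged chain; its time runs over the nonnegative integers. -/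
def tAve {Ω : Type*} [Fintype Ω] [DecidableEq Ω] (P : Matrix Ω Ω ℝ) (π : Ω → ℝ) (ε : ℝ) : ℕ :=
  sInf {t : ℕ | dAve P π t ≤ ε}

/-- The sequence of chains exhibits a continuous-time cutoff with window `w`. -/
def ContCutoffWithWindow {Ω : ℕ → Type*} [∀ n, Fintype (Ω n)] [∀ n, DecidableEq (Ω n)]
    (P : ∀ n, Matrix (Ω n) (Ω n) ℝ) (π : ∀ n, Ω n → ℝ) (w : ℕ → ℝ) : Prop :=
  w =o[atTop] (fun n => tCont (P n) (π n) (1 / 4)) ∧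
    ∀ ε : ℝ, 0 < ε → ε ≤ 1 / 4 → ∃ C : ℝ, 0 < C ∧
      ∀ n, tCont (P n) (π n) ε - tCont (P n) (π n) (1 - ε) ≤ C * w n

/-- The sequence of chains exhibits an averaged cutoff with window `w`. -/
def AveCutoffWithWindow {Ω : ℕ → Type*} [∀ n, Fintype (Ω n)] [∀ n, DecidableEq (Ω n)]
    (P : ∀ n, Matrix (Ω n) (Ω n) ℝ) (π : ∀ n, Ω n → ℝ) (w : ℕ → ℝ) : Prop :=
  w =o[atTop] (fun n => (tAve (P n) (π n) (1 / 4) : ℝ)) ∧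
    ∀ ε : ℝ, 0 < ε → ε ≤ 1 / 4 → ∃ C : ℝ, 0 < C ∧
      ∀ n, (tAve (P n) (π n) ε : ℝ) - (tAve (P n) (π n) (1 - ε) : ℝ) ≤ C * w n

end

/-! Both kernels run the chain for a random time: Poisson of mean t for `heatKernel`, a fair choice
between t and t + 1 for `averagedKernel`. Since Poisson fluctuations have order √t, the two
distances agree up to a time shift of order √t and an error δ, with constants depending on δ alone.

From averaged to continuous (`dCont_le_dAve_add`): by Chebyshev the Poisson time N is rarely below
k, and by Stein's identity replacing P^N by A_N costs only O(1/√t).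

From continuous to averaged (`dAve_le_dCont_add`) reversibility enters: A_{m+1} - A_m = (P^{m+2} -
P^m)/2 has eigenvalues λ^m(λ² - 1)/2, which are O(1/m) on all of [-1, 1]. So after a burn-in of a
large multiple of √t steps, A_m f barely moves in L²(π) during the next O(√t) steps, and the
randomness of N becomes harmless. The L²(π) bound reaches the start x through the common part
min(H_t(x,·), π).

Hence the mixing times agree, after a small change of level, up to O(√T) with T = `tCont (1/4)`. For
(i) this error is absorbed because a continuous-time window has order at least √T: Poisson laws with
means closer than a small multiple of √T are close in χ² (`sqrt_tCont_le`). For (ii) √T is part of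
the window, and only √T = o(T) is needed. Averaged time is an integer and one step cannot cross the
whole transition, so w is bounded below and w = o(`tAve`) forces T → ∞. -/

/-! ### Poisson weights -/

/-- The mass `e^{-t} t^k / k!` that the Poisson distribution of mean `t` gives to `k`. -/
noncomputable def poissonWeight (t : ℝ) (k : ℕ) : ℝ :=
  Real.exp (-t) * t ^ k / (k.factorial : ℝ)

lemma poissonWeight_nonneg {t : ℝ} (ht : 0 ≤ t) (k : ℕ) : 0 ≤ poissonWeight t k := by
  unfold poissonWeight; positivity

lemma poissonWeight_pos {t : ℝ} (ht : 0 < t) (k : ℕ) : 0 < poissonWeight t k := by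
  unfold poissonWeight; positivity

lemma hasSum_pow_div_factorial (t : ℝ) :
    HasSum (fun k : ℕ => t ^ k / (k.factorial : ℝ)) (Real.exp t) := by
  rw [Real.exp_eq_exp_ℝ]
  exact NormedSpace.expSeries_div_hasSum_exp t

lemma hasSum_poissonWeight (t : ℝ) : HasSum (poissonWeight t) 1 := by
  have h := (hasSum_pow_div_factorial t).mul_left (Real.exp (-t))
  rw [← Real.exp_add, neg_add_cancel, Real.exp_zero] at h
  refine h.congr_fun fun k => ?_
  simp [poissonWeight, mul_div_assoc]

lemma succ_mul_poissonWeight_succ (t : ℝ) (k : ℕ) :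
    ((k + 1 : ℕ) : ℝ) * poissonWeight t (k + 1) = t * poissonWeight t k := by
  unfold poissonWeight
  rw [Nat.factorial_succ]
  have : (k.factorial : ℝ) ≠ 0 := by positivity
  have h2 : ((k + 1 : ℕ) : ℝ) ≠ 0 := by positivity
  push_cast at h2 ⊢
  field_simp
  ring

/-- Stein's identity `𝔼[N a(N)] = t 𝔼[a(N+1)]` for a Poisson variable `N` of mean `t`. -/
lemma HasSum.poissonWeight_size_bias {t S : ℝ} {a : ℕ → ℝ}
    (h : HasSum (fun k => poissonWeight t k * a (k + 1)) S) :
    HasSum (fun k : ℕ => poissonWeight t k * (k * a k)) (t * S) := by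
  have h1 : HasSum (fun k : ℕ => poissonWeight t (k + 1) * (((k + 1 : ℕ) : ℝ) * a (k + 1)))
      (t * S) := by
    refine (h.mul_left t).congr_fun fun k => ?_
    rw [mul_left_comm, ← mul_assoc, succ_mul_poissonWeight_succ]
    ring
  have h2 := (hasSum_nat_add_iff (f := fun k : ℕ => poissonWeight t k * (k * a k)) 1).1 h1
  simpa using h2

lemma hasSum_poissonWeight_mul_sq (t : ℝ) :
    HasSum (fun k : ℕ => poissonWeight t k * ((k : ℝ) - t) ^ 2) t := by
  have h0 := hasSum_poissonWeight t
  have h1 : HasSum (fun k : ℕ => poissonWeight t k * k) t := by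
    simpa using HasSum.poissonWeight_size_bias (t := t) (S := 1) (a := fun _ => 1)
      (by simpa using h0)
  have h2 : HasSum (fun k : ℕ => poissonWeight t k * (k * k)) (t * (t + 1)) := by
    refine HasSum.poissonWeight_size_bias (a := fun k => (k : ℝ)) ?_
    refine (h1.add h0).congr_fun fun k => ?_
    push_cast; ring
  have h3 := (h2.add (h1.mul_left (-2 * t))).add (h0.mul_left (t ^ 2))
  convert h3 using 1
  · ext k; ring
  · ring

/-- The χ² distance of two Poisson laws is explicit because squaring the s-weights and dividing by
the t-weights leaves an exponential series in s²/t. -/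
lemma hasSum_poissonWeight_ratio {t s : ℝ} (ht : 0 < t) :
    HasSum (fun k => (poissonWeight s k - poissonWeight t k) ^ 2 / poissonWeight t k)
      (Real.exp ((t - s) ^ 2 / t) - 1) := by
  have h := (hasSum_pow_div_factorial (s ^ 2 / t)).mul_left (Real.exp (t - 2 * s))
  rw [← Real.exp_add] at h
  have h3 := (h.add ((hasSum_poissonWeight s).mul_left (-2))).add (hasSum_poissonWeight t)
  have hv : Real.exp ((t - s) ^ 2 / t) - 1
      = Real.exp (t - 2 * s + s ^ 2 / t) + -2 * 1 + 1 := by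
    have : (t - s) ^ 2 / t = t - 2 * s + s ^ 2 / t := by field_simp; ring
    rw [this]; ring
  rw [hv]
  refine h3.congr_fun fun k => ?_
  · have hp := (poissonWeight_pos ht k).ne'
    have h1 : poissonWeight s k ^ 2 / poissonWeight t k
        = Real.exp (t - 2 * s) * ((s ^ 2 / t) ^ k / (k.factorial : ℝ)) := by
      have hf : (k.factorial : ℝ) ≠ 0 := by positivity
      have he : Real.exp (t - 2 * s) = Real.exp (-s) ^ 2 / Real.exp (-t) := by
        rw [← Real.exp_nat_mul, ← Real.exp_sub]; congr 1; push_cast; ring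
      rw [he]
      unfold poissonWeight
      have := Real.exp_ne_zero (-t)
      rw [div_pow (s ^ 2)]
      field_simp
      ring
    rw [← h1]
    field_simp
    ring

/-! ### Total variation distance -/

section TotalVariation

variable {Ω : Type*} [Fintype Ω]

lemma tvDist_nonneg (μ ν : Ω → ℝ) : 0 ≤ tvDist μ ν := by
  unfold tvDist; positivity

lemma sum_sub_min_eq_tvDist {μ ν : Ω → ℝ} (h : ∑ x, μ x = ∑ x, ν x) :
    ∑ x, (ν x - min (μ x) (ν x)) = tvDist μ ν := by
  have h1 : ∀ x, ν x - min (μ x) (ν x) = (1 / 2) * |μ x - ν x| - (1 / 2) * (μ x - ν x) := by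
    intro x
    rcases le_total (μ x) (ν x) with hx | hx
    · rw [min_eq_left hx, abs_of_nonpos (by linarith)]; ring
    · rw [min_eq_right hx, abs_of_nonneg (by linarith)]; ring
  simp only [h1, Finset.sum_sub_distrib, ← Finset.mul_sum, tvDist, h]
  ring

lemma sum_mul_sub_le_tvDist {μ ν f : Ω → ℝ} (h : ∑ x, μ x = ∑ x, ν x)
    (h0 : ∀ x, 0 ≤ f x) (h1 : ∀ x, f x ≤ 1) :
    ∑ x, ν x * f x - ∑ x, μ x * f x ≤ tvDist μ ν := by
  rw [← sum_sub_min_eq_tvDist h, ← Finset.sum_sub_distrib]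
  refine Finset.sum_le_sum fun x _ => ?_
  have := min_le_left (μ x) (ν x)
  have := min_le_right (μ x) (ν x)
  nlinarith [h0 x, h1 x]

lemma exists_sum_mul_sub_eq_tvDist {μ ν : Ω → ℝ} (h : ∑ x, μ x = ∑ x, ν x) :
    ∃ f : Ω → ℝ, (∀ x, 0 ≤ f x) ∧ (∀ x, f x ≤ 1) ∧
      ∑ x, ν x * f x - ∑ x, μ x * f x = tvDist μ ν := by
  classical
  refine ⟨fun x => if μ x ≤ ν x then 1 else 0, fun x => by dsimp only; split_ifs <;> norm_num,
    fun x => by dsimp only; split_ifs <;> norm_num, ?_⟩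
  rw [← sum_sub_min_eq_tvDist h, ← Finset.sum_sub_distrib]
  refine Finset.sum_congr rfl fun x _ => ?_
  dsimp only
  split_ifs with hx
  · rw [min_eq_left hx]; ring
  · rw [min_eq_right (le_of_not_ge hx)]; ring

/-- Equal masses make one-sided tests enough. Every distance bound below thus becomes a lower bound
on `(K *ᵥ f) x` for 0 ≤ f ≤ 1. -/
lemma tvDist_le_iff {μ ν : Ω → ℝ} (h : ∑ x, μ x = ∑ x, ν x) {c : ℝ} :
    tvDist μ ν ≤ c ↔ ∀ f : Ω → ℝ, (∀ x, 0 ≤ f x) → (∀ x, f x ≤ 1) →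
      ∑ x, ν x * f x - ∑ x, μ x * f x ≤ c := by
  refine ⟨fun hc f h0 h1 => (sum_mul_sub_le_tvDist h h0 h1).trans hc, fun H => ?_⟩
  obtain ⟨f, h0, h1, he⟩ := exists_sum_mul_sub_eq_tvDist h
  exact he ▸ H f h0 h1

lemma tvDist_le_one {μ ν : Ω → ℝ} (hμ : μ ∈ stdSimplex ℝ Ω) (hν : ν ∈ stdSimplex ℝ Ω) :
    tvDist μ ν ≤ 1 := by
  rw [tvDist_le_iff (hμ.2.trans hν.2.symm)]
  intro f h0 h1
  have h2 : ∑ x, ν x * f x ≤ ∑ x, ν x :=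
    Finset.sum_le_sum fun x _ => mul_le_of_le_one_right (hν.1 x) (h1 x)
  have h3 : 0 ≤ ∑ x, μ x * f x := Finset.sum_nonneg fun x _ => mul_nonneg (hμ.1 x) (h0 x)
  linarith [hν.2]

end TotalVariation

/-! ### Stochastic kernels with a stationary distribution -/

section Kernel

open Matrix

variable {Ω : Type*} [Fintype Ω] {K Q : Matrix Ω Ω ℝ} {π f : Ω → ℝ}

/-- If `μ - π` is the image of `ν - π` under a matrix with absolute row sums at most `c`, then
`μ` is at most `c` times as far from `π` as `ν`. -/
lemma tvDist_le_mul_tvDist {μ ν : Ω → ℝ} {M : Matrix Ω Ω ℝ} {c : ℝ}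
    (hM : ∀ z, ∑ y, |M z y| ≤ c) (hμ : ∀ y, μ y - π y = ∑ z, (ν z - π z) * M z y) :
    tvDist μ π ≤ c * tvDist ν π := by
  have h : ∑ y, |μ y - π y| ≤ c * ∑ z, |ν z - π z| := by
    calc ∑ y, |μ y - π y| ≤ ∑ y, ∑ z, |ν z - π z| * |M z y| := by
          refine Finset.sum_le_sum fun y _ => ?_
          rw [hμ]
          refine (Finset.abs_sum_le_sum_abs _ _).trans (le_of_eq ?_)
          simp only [abs_mul]
      _ = ∑ z, |ν z - π z| * ∑ y, |M z y| := by
          rw [Finset.sum_comm]; simp only [Finset.mul_sum]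
      _ ≤ ∑ z, |ν z - π z| * c := Finset.sum_le_sum fun z _ =>
          mul_le_mul_of_nonneg_left (hM z) (abs_nonneg _)
      _ = c * ∑ z, |ν z - π z| := by rw [← Finset.sum_mul, mul_comm]
  unfold tvDist
  linarith

lemma mul_row_sub_eq (hQ : π ᵥ* Q = π) (x y : Ω) :
    (K * Q) x y - π y = ∑ z, (K x z - π z) * Q z y := by
  conv_lhs => rw [← hQ]
  simp [Matrix.mul_apply, vecMul, dotProduct, sub_mul, Finset.sum_sub_distrib]

lemma sum_mul_mulVec (hK : π ᵥ* K = π) (f : Ω → ℝ) :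
    ∑ x, π x * (K *ᵥ f) x = ∑ x, π x * f x := by
  change π ⬝ᵥ (K *ᵥ f) = π ⬝ᵥ f
  rw [dotProduct_mulVec, hK]

variable [DecidableEq Ω]

lemma row_mem_stdSimplex (hK : K ∈ rowStochastic ℝ Ω) (x : Ω) : K x ∈ stdSimplex ℝ Ω :=
  ⟨fun _ => hK.1 _ _, sum_row_of_mem_rowStochastic hK x⟩

lemma sum_row_eq_sum (hK : K ∈ rowStochastic ℝ Ω) (hπ : π ∈ stdSimplex ℝ Ω) (x : Ω) :
    ∑ y, K x y = ∑ y, π y :=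
  (sum_row_of_mem_rowStochastic hK x).trans hπ.2.symm

lemma mulVec_le_one_of_mem_rowStochastic (hK : K ∈ rowStochastic ℝ Ω) (hf : ∀ x, f x ≤ 1)
    (x : Ω) : (K *ᵥ f) x ≤ 1 := by
  rw [← sum_row_of_mem_rowStochastic hK x]
  exact Finset.sum_le_sum fun y _ => mul_le_of_le_one_right (hK.1 x y) (hf y)

lemma mulVec_le_mulVec_of_mem_rowStochastic (hK : K ∈ rowStochastic ℝ Ω) {g : Ω → ℝ}
    (hfg : ∀ x, f x ≤ g x) (x : Ω) : (K *ᵥ f) x ≤ (K *ᵥ g) x :=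
  Finset.sum_le_sum fun y _ => mul_le_mul_of_nonneg_left (hfg y) (hK.1 x y)

lemma sum_abs_row_eq_one (hK : K ∈ rowStochastic ℝ Ω) (x : Ω) : ∑ y, |K x y| = 1 := by
  rw [← sum_row_of_mem_rowStochastic hK x]
  exact Finset.sum_congr rfl fun y _ => abs_of_nonneg (hK.1 x y)

lemma tvDist_mul_row_le (hQ : Q ∈ rowStochastic ℝ Ω) (hQπ : π ᵥ* Q = π) (x : Ω) :
    tvDist ((K * Q) x) π ≤ tvDist (K x) π := by
  simpa using tvDist_le_mul_tvDist (c := 1) (fun z => (sum_abs_row_eq_one hQ z).le)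
    (mul_row_sub_eq (K := K) hQπ x)

/-- The signed measure K x - π has mass zero, so π may be subtracted from each row of Q; what
remains has absolute row sums at most 2c. This is the submultiplicativity of twice the distance. -/
lemma tvDist_mul_row_le_mul (hK : K ∈ rowStochastic ℝ Ω) (hπ : π ∈ stdSimplex ℝ Ω)
    (hQπ : π ᵥ* Q = π) {c : ℝ} (hc : ∀ z, tvDist (Q z) π ≤ c) (x : Ω) :
    tvDist ((K * Q) x) π ≤ 2 * c * tvDist (K x) π := by
  refine tvDist_le_mul_tvDist (M := fun z y => Q z y - π y) (fun z => ?_) fun y => ?_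
  · have := hc z
    unfold tvDist at this
    linarith
  · rw [mul_row_sub_eq hQπ]
    simp only [mul_sub, Finset.sum_sub_distrib, ← Finset.sum_mul]
    rw [sum_row_eq_sum hK hπ]
    ring

/-- Doeblin's contraction: a constant subtracted from Q is invisible to a signed measure of mass
zero. -/
lemma tvDist_mul_row_le_of_le (hK : K ∈ rowStochastic ℝ Ω) (hπ : π ∈ stdSimplex ℝ Ω)
    (hQ : Q ∈ rowStochastic ℝ Ω) (hQπ : π ᵥ* Q = π) {c : ℝ} (hc : ∀ z y, c ≤ Q z y) (x : Ω) :
    tvDist ((K * Q) x) π ≤ (1 - Fintype.card Ω * c) * tvDist (K x) π := by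
  refine tvDist_le_mul_tvDist (M := fun z y => Q z y - c) (fun z => ?_) fun y => ?_
  · have : ∀ y, |Q z y - c| = Q z y - c := fun y => abs_of_nonneg (sub_nonneg.2 (hc z y))
    simp [this, Finset.sum_sub_distrib, sum_row_of_mem_rowStochastic hQ z]
  · rw [mul_row_sub_eq hQπ]
    simp only [mul_sub, Finset.sum_sub_distrib, ← Finset.sum_mul]
    rw [sum_row_eq_sum hK hπ]
    ring

end Kernel

/-! ### The averaged and continuous-time kernels -/

section Semigroup

open Matrix

variable {Ω : Type*} [Fintype Ω] [DecidableEq Ω]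

lemma averagedKernel_eq (P : Matrix Ω Ω ℝ) (k : ℕ) :
    averagedKernel P k = (1 / 2 : ℝ) • P ^ k + (1 / 2 : ℝ) • P ^ (k + 1) := by
  ext x y
  simp [averagedKernel]
  ring

lemma averagedKernel_mulVec (P : Matrix Ω Ω ℝ) (k : ℕ) (f : Ω → ℝ) (x : Ω) :
    (averagedKernel P k *ᵥ f) x = ((P ^ k *ᵥ f) x + (P ^ (k + 1) *ᵥ f) x) / 2 := by
  simp [averagedKernel_eq, add_mulVec, smul_mulVec]
  ring

lemma averagedKernel_add (P : Matrix Ω Ω ℝ) (j k : ℕ) :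
    averagedKernel P (j + k) = P ^ j * averagedKernel P k := by
  simp only [averagedKernel_eq, mul_add, mul_smul_comm, ← pow_add, add_assoc]

lemma averagedKernel_succ (P : Matrix Ω Ω ℝ) (k : ℕ) :
    averagedKernel P (k + 1) = averagedKernel P k * P := by
  simp only [averagedKernel_eq, add_mul, smul_mul_assoc, ← pow_succ]

/-- The exponential form yields the semigroup law, the entrywise series the reading as a Poisson
average. -/
lemma heatKernel_eq_exp (P : Matrix Ω Ω ℝ) (t : ℝ) :
    heatKernel P t = Real.exp (-t) • NormedSpace.exp (t • P) ∧
      ∀ x y, HasSum (fun k => poissonWeight t k * (P ^ k) x y) (heatKernel P t x y) := by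
  have h1 : HasSum (fun k : ℕ => ((k.factorial : ℝ)⁻¹) • (t • P) ^ k)
      (NormedSpace.exp (t • P)) :=
    open scoped Norms.Operator in NormedSpace.exp_series_hasSum_exp' (𝕂 := ℝ) (t • P)
  have h2 : ∀ x y, HasSum (fun k => poissonWeight t k * (P ^ k) x y)
      ((Real.exp (-t) • NormedSpace.exp (t • P)) x y) := by
    intro x y
    have h3 := (Pi.hasSum.1 (Pi.hasSum.1 h1 x) y).mul_left (Real.exp (-t))
    refine h3.congr_fun fun k => ?_
    simp [poissonWeight, smul_pow]
    ring
  have h4 : heatKernel P t = Real.exp (-t) • NormedSpace.exp (t • P) := by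
    ext x y
    exact (h2 x y).tsum_eq
  exact ⟨h4, h4 ▸ h2⟩

lemma heatKernel_zero (P : Matrix Ω Ω ℝ) : heatKernel P 0 = 1 := by
  simp [(heatKernel_eq_exp P 0).1]

lemma heatKernel_add (P : Matrix Ω Ω ℝ) (s t : ℝ) :
    heatKernel P (s + t) = heatKernel P s * heatKernel P t := by
  simp only [(heatKernel_eq_exp P _).1]
  rw [add_smul, Matrix.exp_add_of_commute _ _ ((Commute.refl P).smul_left s |>.smul_right t),
    smul_mul_smul_comm, ← Real.exp_add, neg_add]

lemma hasSum_heatKernel_mulVec (P : Matrix Ω Ω ℝ) (t : ℝ) (f : Ω → ℝ) (x : Ω) :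
    HasSum (fun k => poissonWeight t k * (P ^ k *ᵥ f) x) ((heatKernel P t *ᵥ f) x) := by
  have := hasSum_sum (s := Finset.univ) fun y _ =>
    ((heatKernel_eq_exp P t).2 x y).mul_right (f y)
  refine this.congr_fun fun k => ?_
  simp [mulVec, dotProduct, Finset.mul_sum, mul_assoc]

end Semigroup

namespace IsReversibleChain

open Matrix

variable {Ω : Type*} [Fintype Ω] [DecidableEq Ω] {P : Matrix Ω Ω ℝ} {π f : Ω → ℝ}

lemma nonempty (h : IsReversibleChain P π) : Nonempty Ω := by
  by_contra hne
  rw [not_nonempty_iff] at hne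
  simpa using h.distribution.2

lemma vecMul_eq (h : IsReversibleChain P π) : π ᵥ* P = π := by
  ext y
  calc ∑ x, π x * P x y = ∑ x, π y * P y x := Finset.sum_congr rfl fun x _ =>
        h.detailed_balance x y
    _ = π y := by
        rw [← Finset.mul_sum, sum_row_of_mem_rowStochastic h.stochastic, mul_one]

lemma vecMul_pow_eq (h : IsReversibleChain P π) (k : ℕ) : π ᵥ* (P ^ k) = π := by
  induction k with
  | zero => simp
  | succ k ih => rw [pow_succ, ← vecMul_vecMul, ih, h.vecMul_eq]

lemma pow_mem_rowStochastic (h : IsReversibleChain P π) (k : ℕ) : P ^ k ∈ rowStochastic ℝ Ω :=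
  Submonoid.pow_mem _ h.stochastic k

lemma averagedKernel_mem (h : IsReversibleChain P π) (k : ℕ) :
    averagedKernel P k ∈ rowStochastic ℝ Ω := by
  rw [averagedKernel_eq]
  exact convex_rowStochastic (h.pow_mem_rowStochastic k) (h.pow_mem_rowStochastic (k + 1))
    (by norm_num) (by norm_num) (by norm_num)

lemma vecMul_averagedKernel (h : IsReversibleChain P π) (k : ℕ) :
    π ᵥ* averagedKernel P k = π := by
  rw [averagedKernel_eq, vecMul_add, vecMul_smul, vecMul_smul, h.vecMul_pow_eq,
    h.vecMul_pow_eq, ← add_smul]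
  norm_num

lemma heatKernel_mem (h : IsReversibleChain P π) {t : ℝ} (ht : 0 ≤ t) :
    heatKernel P t ∈ rowStochastic ℝ Ω := by
  refine ⟨fun x y => ((heatKernel_eq_exp P t).2 x y).nonneg fun k =>
    mul_nonneg (poissonWeight_nonneg ht k) ((h.pow_mem_rowStochastic k).1 x y), ?_⟩
  ext x
  refine (hasSum_heatKernel_mulVec P t 1 x).unique ?_
  simpa [(h.pow_mem_rowStochastic _).2] using hasSum_poissonWeight t

lemma vecMul_heatKernel (h : IsReversibleChain P π) (t : ℝ) : π ᵥ* heatKernel P t = π := by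
  ext y
  have h1 := hasSum_sum (s := Finset.univ) fun x _ =>
    ((heatKernel_eq_exp P t).2 x y).mul_left (π x)
  refine h1.unique ?_
  have h2 := (hasSum_poissonWeight t).mul_right (π y)
  rw [one_mul] at h2
  refine h2.congr_fun fun k => ?_
  have h3 : ∑ x, π x * (P ^ k) x y = π y := congrFun (h.vecMul_pow_eq k) y
  rw [← h3, Finset.mul_sum]
  exact Finset.sum_congr rfl fun x _ => by ring

end IsReversibleChain

/-! ### Regularity in time of the averaged chain -/

/-- The second differences of a nonnegative, decreasing, convex sequence with decreasing second
differences decay quadratically. -/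
lemma second_difference_le {a : ℕ → ℝ} (h0 : ∀ j, 0 ≤ a j) (h1 : Antitone a)
    (h2 : ∀ j, 0 ≤ a j - 2 * a (j + 1) + a (j + 2))
    (h3 : Antitone fun j => a j - 2 * a (j + 1) + a (j + 2)) (n : ℕ) :
    (n + 1 : ℝ) ^ 2 * (a (2 * n) - 2 * a (2 * n + 1) + a (2 * n + 2)) ≤ a 0 := by
  have hc : Antitone fun j => a j - a (j + 1) :=
    antitone_nat_of_succ_le fun j => by have := h2 j; linarith
  have hc0 : ∀ j, 0 ≤ a j - a (j + 1) := fun j => sub_nonneg.2 (h1 (Nat.le_succ j))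
  -- The n + 1 first differences at 0, …, n telescope to at most a 0, and the last is the smallest.
  have e1 : (n + 1 : ℝ) * (a n - a (n + 1)) ≤ a 0 := by
    have := Finset.card_nsmul_le_sum (Finset.range (n + 1)) (fun j => a j - a (j + 1))
      (a n - a (n + 1)) fun j hj => hc (Nat.lt_succ_iff.1 (Finset.mem_range.1 hj))
    rw [Finset.sum_range_sub' a, Finset.card_range, nsmul_eq_mul] at this
    push_cast at this
    linarith [h0 (n + 1)]
  -- The same argument one order higher, over the indices n, …, 2n.
  have e2 : (n + 1 : ℝ) * (a (2 * n) - 2 * a (2 * n + 1) + a (2 * n + 2))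
      ≤ a n - a (n + 1) := by
    have := Finset.card_nsmul_le_sum (Finset.range (n + 1))
      (fun j => (a (n + j) - a (n + j + 1)) - (a (n + (j + 1)) - a (n + (j + 1) + 1)))
      (a (2 * n) - 2 * a (2 * n + 1) + a (2 * n + 2)) fun j hj => by
        have hj : n + j ≤ 2 * n := by have := Finset.mem_range.1 hj; lia
        refine (h3 hj).trans (le_of_eq ?_)
        dsimp only
        rw [← add_assoc]
        ring_nf
    rw [Finset.sum_range_sub' (fun j => a (n + j) - a (n + j + 1)), Finset.card_range,
      nsmul_eq_mul] at this
    push_cast at this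
    rw [add_zero] at this
    linarith [hc0 (n + (n + 1))]
  calc (n + 1 : ℝ) ^ 2 * (a (2 * n) - 2 * a (2 * n + 1) + a (2 * n + 2))
      = (n + 1) * ((n + 1) * (a (2 * n) - 2 * a (2 * n + 1) + a (2 * n + 2))) := by ring
    _ ≤ (n + 1) * (a n - a (n + 1)) := mul_le_mul_of_nonneg_left e2 (by positivity)
    _ ≤ a 0 := e1

namespace IsReversibleChain

open Matrix

variable {Ω : Type*} [Fintype Ω] [DecidableEq Ω] {P : Matrix Ω Ω ℝ} {π f : Ω → ℝ}

lemma sum_mul_mulVec_mul (h : IsReversibleChain P π) (f g : Ω → ℝ) :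
    ∑ x, π x * ((P *ᵥ f) x * g x) = ∑ x, π x * (f x * (P *ᵥ g) x) := by
  simp only [mulVec, dotProduct, Finset.mul_sum, Finset.sum_mul]
  rw [Finset.sum_comm]
  refine Finset.sum_congr rfl fun y _ => Finset.sum_congr rfl fun x _ => ?_
  have := h.detailed_balance x y
  linear_combination f y * g x * this

lemma sum_mul_mulVec_sq_le (h : IsReversibleChain P π) (f : Ω → ℝ) :
    ∑ x, π x * (P *ᵥ f) x ^ 2 ≤ ∑ x, π x * f x ^ 2 := by
  rw [← sum_mul_mulVec h.vecMul_eq (fun x => f x ^ 2)]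
  refine Finset.sum_le_sum fun x _ => mul_le_mul_of_nonneg_left ?_ (h.distribution.1 x)
  exact Real.pow_arith_mean_le_arith_mean_pow_of_even Finset.univ _ _
    (fun y _ => h.stochastic.1 x y) (sum_row_of_mem_rowStochastic h.stochastic x) even_two

/-- With a_j the squared L²(π) norm of P^j f, self-adjointness gives ⟨P^j f, P^{j+2} f⟩ = a_{j+1},
so the left-hand sum is a second difference of a. Contractivity of P supplies the monotonicity that
`second_difference_le` needs, without diagonalising P. -/
lemma sum_mul_pow_mulVec_sub_sq_le (h : IsReversibleChain P π) {n m : ℕ} (hm : 2 * n ≤ m)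
    (f : Ω → ℝ) :
    (n + 1 : ℝ) ^ 2 * ∑ x, π x * ((P ^ m *ᵥ f) x - (P ^ (m + 2) *ᵥ f) x) ^ 2
      ≤ ∑ x, π x * f x ^ 2 := by
  set a : ℕ → ℝ := fun j => ∑ x, π x * (P ^ j *ᵥ f) x ^ 2 with ha
  have hsucc : ∀ (j : ℕ) (g : Ω → ℝ), P ^ (j + 1) *ᵥ g = P *ᵥ (P ^ j *ᵥ g) := fun j g => by
    rw [pow_succ', mulVec_mulVec]
  have hb : ∀ j, a j - 2 * a (j + 1) + a (j + 2)
      = ∑ x, π x * ((P ^ j *ᵥ f) x - (P ^ (j + 2) *ᵥ f) x) ^ 2 := by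
    intro j
    have h1 := h.sum_mul_mulVec_mul (P ^ j *ᵥ f) (P ^ (j + 1) *ᵥ f)
    rw [← hsucc, ← hsucc] at h1
    have h2 : a (j + 1) = ∑ x, π x * ((P ^ j *ᵥ f) x * (P ^ (j + 2) *ᵥ f) x) := by
      rw [← h1]; simp only [ha, sq]
    rw [h2]
    simp only [ha, Finset.mul_sum, ← Finset.sum_sub_distrib, ← Finset.sum_add_distrib]
    exact Finset.sum_congr rfl fun x _ => by ring
  have hanti : Antitone fun j => a j - 2 * a (j + 1) + a (j + 2) := by
    refine antitone_nat_of_succ_le fun j => ?_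
    simp only [hb]
    have h1 := h.sum_mul_mulVec_sq_le (P ^ j *ᵥ f - P ^ (j + 2) *ᵥ f)
    rw [mulVec_sub, ← hsucc, ← hsucc] at h1
    exact h1
  have key := second_difference_le (a := a)
    (fun j => Finset.sum_nonneg fun x _ => mul_nonneg (h.distribution.1 x) (sq_nonneg _))
    (antitone_nat_of_succ_le fun j => by
      simp only [ha, hsucc]; exact h.sum_mul_mulVec_sq_le _)
    (fun j => by
      rw [hb]
      exact Finset.sum_nonneg fun x _ => mul_nonneg (h.distribution.1 x) (sq_nonneg _))
    hanti n
  rw [← hb]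
  have h0 : a 0 = ∑ x, π x * f x ^ 2 := by simp [ha]
  rw [← h0]
  exact (mul_le_mul_of_nonneg_left (hanti hm) (by positivity)).trans key

/-- In A_{m+1} - A_m the P^{m+1} terms cancel, leaving a two-step difference that periodicity does
not spoil. Jensen passes from L² to L¹. -/
lemma sum_mul_abs_averagedKernel_sub_le (h : IsReversibleChain P π) {n m : ℕ}
    (hm : 2 * n ≤ m) (hf0 : ∀ x, 0 ≤ f x) (hf1 : ∀ x, f x ≤ 1) :
    ∑ x, π x * |(averagedKernel P (m + 1) *ᵥ f) x - (averagedKernel P m *ᵥ f) x|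
      ≤ 1 / (2 * (n + 1)) := by
  set v : Ω → ℝ := fun x => (P ^ m *ᵥ f) x - (P ^ (m + 2) *ᵥ f) x with hv
  have h1 : ∀ x, |(averagedKernel P (m + 1) *ᵥ f) x - (averagedKernel P m *ᵥ f) x|
      = (1 / 2) * |v x| := by
    intro x
    rw [averagedKernel_mulVec, averagedKernel_mulVec, abs_sub_comm, ← abs_of_pos (a := (1 / 2 : ℝ))
      (by norm_num), ← abs_mul]
    congr 1
    simp only [hv, add_assoc, one_add_one_eq_two]
    ring
  have h2 : (∑ x, π x * |v x|) ^ 2 ≤ ∑ x, π x * |v x| ^ 2 :=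
    Real.pow_arith_mean_le_arith_mean_pow Finset.univ _ _ (fun x _ => h.distribution.1 x)
      h.distribution.2 (fun x _ => abs_nonneg _) 2
  simp only [sq_abs] at h2
  have h3 := h.sum_mul_pow_mulVec_sub_sq_le hm f
  have h4 : ∑ x, π x * f x ^ 2 ≤ 1 := by
    rw [← h.distribution.2]
    exact Finset.sum_le_sum fun x _ => mul_le_of_le_one_right (h.distribution.1 x)
      (pow_le_one₀ (hf0 x) (hf1 x))
  have h5 : (n + 1 : ℝ) * ∑ x, π x * |v x| ≤ 1 := by
    refine abs_le_of_sq_le_sq' ?_ zero_le_one |>.2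
    rw [mul_pow, one_pow]
    exact (mul_le_mul_of_nonneg_left h2 (by positivity)).trans (h3.trans h4)
  simp only [h1, mul_left_comm _ (1 / 2 : ℝ), ← Finset.mul_sum]
  rw [le_div_iff₀ (by positivity)]
  linarith

/-! ### The averaged chain mixes soon after the continuous-time chain -/

/-- For a Poisson time N within l of t, split A_k = P^N A_{2n+i} with i = ⌈t + l⌉ - N. Replacing
A_{2n+i} f by A_{2n} f, at the price of its variation g, removes the dependence on N, and averaging
over N turns P^N into H_t. Chebyshev gives the error t / l², the mean of g the error (l + 1) / (n +
1). -/
lemma sub_averagedKernel_mulVec_le (h : IsReversibleChain P π) {t l : ℝ} (ht : 0 ≤ t)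
    (hl : 0 < l) (n : ℕ) (hf0 : ∀ x, 0 ≤ f x) (hf1 : ∀ x, f x ≤ 1) (x : Ω) :
    ∑ y, π y * f y - (averagedKernel P (⌈t + l⌉₊ + 2 * n) *ᵥ f) x
      ≤ tvDist (heatKernel P t x) π + t / l ^ 2 + (l + 1) / (n + 1) := by
  set k := ⌈t + l⌉₊ + 2 * n with hk
  -- The shift ⌈t + l⌉ - N is less than 2l + 1 when N > t - l.
  set L := ⌊2 * l + 1⌋₊ with hL
  set A : ℕ → Ω → ℝ := fun m => averagedKernel P m *ᵥ f with hA
  have hA0 : ∀ m y, 0 ≤ A m y := fun m =>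
    nonneg_mulVec_of_mem_rowStochastic (h.averagedKernel_mem m) hf0
  have hA1 : ∀ m y, A m y ≤ 1 := fun m =>
    mulVec_le_one_of_mem_rowStochastic (h.averagedKernel_mem m) hf1
  set g : Ω → ℝ := fun y => ∑ i ∈ Finset.range L, |A (2 * n + i + 1) y - A (2 * n + i) y| with hg
  have hg0 : ∀ y, 0 ≤ g y := fun y => Finset.sum_nonneg fun i _ => abs_nonneg _
  have hAg : ∀ i ≤ L, ∀ y, A (2 * n) y - g y ≤ A (2 * n + i) y := by
    intro i hi y
    have h1 := Finset.sum_range_sub (fun i => A (2 * n + i) y) i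
    have h2 : |∑ j ∈ Finset.range i, (A (2 * n + (j + 1)) y - A (2 * n + j) y)| ≤ g y :=
      (Finset.abs_sum_le_sum_abs _ _).trans
        (Finset.sum_le_sum_of_subset_of_nonneg (Finset.range_mono hi) fun _ _ _ => abs_nonneg _)
    rw [h1] at h2
    have := (abs_le.1 h2).1
    simp only [add_zero] at this
    linarith
  set H := heatKernel P t with hH
  have hHm : H ∈ rowStochastic ℝ Ω := h.heatKernel_mem ht
  -- The variation g is small only on π-average. The density θ cuts H x down to its common part with
  -- π, under which g is controlled. Where H x y = 0 the division gives 0, consistently with `hθH`.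
  set θ : Ω → ℝ := fun y => min (H x y) (π y) / H x y with hθ
  have hθ0 : ∀ y, 0 ≤ θ y := fun y =>
    div_nonneg (le_min (hHm.1 x y) (h.distribution.1 y)) (hHm.1 x y)
  have hθ1 : ∀ y, θ y ≤ 1 := fun y => div_le_one_of_le₀ (min_le_left _ _) (hHm.1 x y)
  have hθH : ∀ y, H x y * θ y = min (H x y) (π y) := by
    intro y
    rcases eq_or_ne (H x y) 0 with h0 | h0
    · rw [h0, zero_mul, min_eq_left (h.distribution.1 y)]
    · exact mul_div_cancel₀ _ h0
  set F : Ω → ℝ := fun y => θ y * (A (2 * n) y - g y) with hF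
  have hF1 : ∀ y, F y ≤ 1 := fun y => by
    have := hA1 (2 * n) y
    have := hg0 y
    nlinarith [hθ0 y, hθ1 y]
  have hPF : ∀ N : ℕ, (P ^ N *ᵥ F) x ≤ A k x + ((N : ℝ) - t) ^ 2 / l ^ 2 := by
    intro N
    by_cases hN : |(N : ℝ) - t| < l
    · rw [abs_lt] at hN
      have h1 : N ≤ ⌈t + l⌉₊ := by
        have : (N : ℝ) ≤ ⌈t + l⌉₊ := by linarith [Nat.le_ceil (t + l)]
        exact_mod_cast this
      have h2 : ⌈t + l⌉₊ - N ≤ L := by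
        refine Nat.le_floor ?_
        rw [Nat.cast_sub h1]
        linarith [Nat.ceil_lt_add_one (show 0 ≤ t + l by linarith)]
      have h3 : k = N + (2 * n + (⌈t + l⌉₊ - N)) := by lia
      have h4 : A k = P ^ N *ᵥ A (2 * n + (⌈t + l⌉₊ - N)) := by
        simp only [hA]
        rw [mulVec_mulVec, ← averagedKernel_add, ← h3]
      rw [h4]
      refine (mulVec_le_mulVec_of_mem_rowStochastic (h.pow_mem_rowStochastic N)
        (fun y => ?_) x).trans (le_add_of_nonneg_right (by positivity))
      have h5 := hAg _ h2 y
      have h6 := hA0 (2 * n + (⌈t + l⌉₊ - N)) y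
      calc θ y * (A (2 * n) y - g y) ≤ θ y * A (2 * n + (⌈t + l⌉₊ - N)) y :=
            mul_le_mul_of_nonneg_left h5 (hθ0 y)
        _ ≤ _ := mul_le_of_le_one_left h6 (hθ1 y)
    · have h1 : 1 ≤ ((N : ℝ) - t) ^ 2 / l ^ 2 := by
        rw [le_div_iff₀ (by positivity), one_mul, ← sq_abs ((N : ℝ) - t)]
        exact pow_le_pow_left₀ hl.le (not_lt.1 hN) 2
      have h2 := mulVec_le_one_of_mem_rowStochastic (h.pow_mem_rowStochastic N) hF1 x
      linarith [hA0 k x]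
  have hHF : (H *ᵥ F) x ≤ A k x + t / l ^ 2 := by
    have h1 := hasSum_heatKernel_mulVec P t F x
    have h2 := ((hasSum_poissonWeight t).mul_right (A k x)).add
      ((hasSum_poissonWeight_mul_sq t).div_const (l ^ 2))
    rw [one_mul] at h2
    refine hasSum_le (fun N => ?_) h1 h2
    have := mul_le_mul_of_nonneg_left (hPF N) (poissonWeight_nonneg ht N)
    rw [mul_add, ← mul_div_assoc] at this
    exact this
  have hmin : (H *ᵥ F) x = ∑ y, min (H x y) (π y) * (A (2 * n) y - g y) := by
    simp only [mulVec, dotProduct, hF, ← mul_assoc, hθH]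
  -- Passing from π to the common part loses mass equal to the total variation distance, on which
  -- A_{2n} f ≤ 1; stationarity turns the π-mean of A_{2n} f into that of f.
  have hlow : ∑ y, π y * f y - tvDist (H x) π - ∑ y, π y * g y ≤ (H *ᵥ F) x := by
    rw [hmin, ← sum_sub_min_eq_tvDist (sum_row_eq_sum hHm h.distribution x),
      ← sum_mul_mulVec (h.vecMul_averagedKernel (2 * n)) f, ← Finset.sum_sub_distrib,
      ← Finset.sum_sub_distrib]
    refine Finset.sum_le_sum fun y _ => ?_
    change π y * A (2 * n) y - _ - _ ≤ _
    have := hA0 (2 * n) y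
    have := hA1 (2 * n) y
    have := hg0 y
    have := min_le_right (H x y) (π y)
    nlinarith
  have hgbound : ∑ y, π y * g y ≤ (l + 1) / (n + 1) := by
    simp only [hg, Finset.mul_sum]
    rw [Finset.sum_comm]
    have h1 := Finset.sum_le_card_nsmul (Finset.range L)
      (fun i => ∑ y, π y * |A (2 * n + i + 1) y - A (2 * n + i) y|) (1 / (2 * (n + 1)))
      fun i _ => h.sum_mul_abs_averagedKernel_sub_le (Nat.le_add_right _ _) hf0 hf1
    refine h1.trans ?_
    rw [Finset.card_range, nsmul_eq_mul, mul_one_div, div_le_div_iff₀ (by positivity)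
      (by positivity)]
    have : (L : ℝ) ≤ 2 * l + 1 := Nat.floor_le (by positivity)
    nlinarith [show (0 : ℝ) < n + 1 by positivity]
  change ∑ y, π y * f y - A k x ≤ _
  linarith

end IsReversibleChain

/-! ### Distances to stationarity -/

section Distance

variable {Ω : Type*} [Fintype Ω] [DecidableEq Ω]

lemma tvDist_heatKernel_le_dCont (P : Matrix Ω Ω ℝ) (π : Ω → ℝ) (t : ℝ) (x : Ω) :
    tvDist (heatKernel P t x) π ≤ dCont P π t :=
  le_ciSup (f := fun x => tvDist (heatKernel P t x) π) (Set.finite_range _).bddAbove x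

lemma tvDist_averagedKernel_le_dAve (P : Matrix Ω Ω ℝ) (π : Ω → ℝ) (k : ℕ) (x : Ω) :
    tvDist (averagedKernel P k x) π ≤ dAve P π k :=
  le_ciSup (f := fun x => tvDist (averagedKernel P k x) π) (Set.finite_range _).bddAbove x

lemma dCont_nonneg (P : Matrix Ω Ω ℝ) (π : Ω → ℝ) (t : ℝ) : 0 ≤ dCont P π t :=
  Real.iSup_nonneg fun _ => tvDist_nonneg _ _

lemma dAve_nonneg (P : Matrix Ω Ω ℝ) (π : Ω → ℝ) (k : ℕ) : 0 ≤ dAve P π k :=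
  Real.iSup_nonneg fun _ => tvDist_nonneg _ _

end Distance

namespace IsReversibleChain

open Matrix

variable {Ω : Type*} [Fintype Ω] [DecidableEq Ω] {P : Matrix Ω Ω ℝ} {π f : Ω → ℝ}

lemma dCont_le_iff (h : IsReversibleChain P π) {t c : ℝ} (ht : 0 ≤ t) :
    dCont P π t ≤ c ↔ ∀ x, ∀ f : Ω → ℝ, (∀ y, 0 ≤ f y) → (∀ y, f y ≤ 1) →
      ∑ y, π y * f y - (heatKernel P t *ᵥ f) x ≤ c := by
  have := h.nonempty
  refine ⟨fun hc x => (tvDist_le_iff (sum_row_eq_sum (h.heatKernel_mem ht) h.distribution x)).1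
    ((tvDist_heatKernel_le_dCont P π t x).trans hc), fun H => ciSup_le fun x => ?_⟩
  exact (tvDist_le_iff (sum_row_eq_sum (h.heatKernel_mem ht) h.distribution x)).2 (H x)

lemma dAve_le_iff (h : IsReversibleChain P π) {k : ℕ} {c : ℝ} :
    dAve P π k ≤ c ↔ ∀ x, ∀ f : Ω → ℝ, (∀ y, 0 ≤ f y) → (∀ y, f y ≤ 1) →
      ∑ y, π y * f y - (averagedKernel P k *ᵥ f) x ≤ c := by
  have := h.nonempty
  refine ⟨fun hc x => (tvDist_le_iff (sum_row_eq_sum (h.averagedKernel_mem k) h.distribution x)).1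
    ((tvDist_averagedKernel_le_dAve P π k x).trans hc), fun H => ciSup_le fun x => ?_⟩
  exact (tvDist_le_iff (sum_row_eq_sum (h.averagedKernel_mem k) h.distribution x)).2 (H x)

lemma dAve_antitone (h : IsReversibleChain P π) : Antitone (dAve P π) := by
  have := h.nonempty
  refine antitone_nat_of_succ_le fun k => ciSup_le fun x => ?_
  rw [averagedKernel_succ]
  exact (tvDist_mul_row_le h.stochastic h.vecMul_eq x).trans
    (tvDist_averagedKernel_le_dAve P π k x)

lemma dCont_anti (h : IsReversibleChain P π) {s t : ℝ} (hst : s ≤ t) :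
    dCont P π t ≤ dCont P π s := by
  have := h.nonempty
  refine ciSup_le fun x => ?_
  rw [← add_sub_cancel s t, heatKernel_add]
  exact (tvDist_mul_row_le (h.heatKernel_mem (sub_nonneg.2 hst)) (h.vecMul_heatKernel _) x).trans
    (tvDist_heatKernel_le_dCont P π s x)

lemma dCont_add_le (h : IsReversibleChain P π) {s t : ℝ} (hs : 0 ≤ s) :
    dCont P π (s + t) ≤ 2 * dCont P π t * dCont P π s := by
  have := h.nonempty
  refine ciSup_le fun x => ?_
  rw [heatKernel_add]
  refine (tvDist_mul_row_le_mul (h.heatKernel_mem hs) h.distribution (h.vecMul_heatKernel _)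
    (tvDist_heatKernel_le_dCont P π t) x).trans ?_
  exact mul_le_mul_of_nonneg_left (tvDist_heatKernel_le_dCont P π s x)
    (mul_nonneg zero_le_two (dCont_nonneg P π t))

lemma dCont_le_one (h : IsReversibleChain P π) {t : ℝ} (ht : 0 ≤ t) : dCont P π t ≤ 1 :=
  have := h.nonempty
  ciSup_le fun x => tvDist_le_one (row_mem_stdSimplex (h.heatKernel_mem ht) x) h.distribution

lemma dCont_nat_mul_le (h : IsReversibleChain P π) {t : ℝ} (ht : 0 ≤ t)
    (h4 : dCont P π t ≤ 1 / 4) (j : ℕ) : dCont P π (j * t) ≤ (1 / 2) ^ j := by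
  induction j with
  | zero => simpa using h.dCont_le_one le_rfl
  | succ j ih =>
    have h1 := h.dCont_add_le (s := j * t) (t := t) (by positivity)
    have h2 : ((j + 1 : ℕ) : ℝ) * t = j * t + t := by push_cast; ring
    rw [h2, pow_succ]
    have := dCont_nonneg P π (j * t)
    nlinarith

lemma heatKernel_one_pos (h : IsReversibleChain P π) (x y : Ω) : 0 < heatKernel P 1 x y := by
  obtain ⟨k, -, hk⟩ :=
    (isIrreducible_iff_exists_pow_pos h.stochastic.1).1 h.irreducible x y
  have h1 := (heatKernel_eq_exp P 1).2 x y
  have h2 := le_hasSum h1 k fun j _ =>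
    mul_nonneg (poissonWeight_nonneg zero_le_one j) ((h.pow_mem_rowStochastic j).1 x y)
  exact (mul_pos (poissonWeight_pos one_pos k) hk).trans_le h2

/-- Irreducibility makes H_1 strictly positive, so Doeblin's contraction gives geometric decay. The
infima defining the mixing times are therefore over nonempty sets. -/
lemma exists_dCont_le (h : IsReversibleChain P π) {ε : ℝ} (hε : 0 < ε) :
    ∃ t : ℝ, 0 ≤ t ∧ dCont P π t ≤ ε := by
  have := h.nonempty
  obtain ⟨q, hq⟩ := Finite.exists_min fun q : Ω × Ω => heatKernel P 1 q.1 q.2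
  set c := heatKernel P 1 q.1 q.2 with hc
  have hc0 : 0 < c := h.heatKernel_one_pos _ _
  have hle : ∀ z y, c ≤ heatKernel P 1 z y := fun z y => hq (z, y)
  set r := 1 - Fintype.card Ω * c with hr
  have hr1 : r < 1 := by
    have : (0 : ℝ) < Fintype.card Ω := by exact_mod_cast Fintype.card_pos
    have := mul_pos this hc0
    linarith
  have hr0 : 0 ≤ r := by
    have h1 := Finset.sum_le_sum fun y (_ : y ∈ Finset.univ) => hle q.1 y
    rw [sum_row_of_mem_rowStochastic (h.heatKernel_mem zero_le_one)] at h1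
    simp at h1
    linarith
  have hpow : ∀ n : ℕ, dCont P π n ≤ r ^ n := by
    intro n
    induction n with
    | zero => simpa using h.dCont_le_one le_rfl
    | succ n ih =>
      refine ciSup_le fun x => ?_
      push_cast
      rw [heatKernel_add, pow_succ']
      refine (tvDist_mul_row_le_of_le (h.heatKernel_mem n.cast_nonneg) h.distribution
        (h.heatKernel_mem zero_le_one) (h.vecMul_heatKernel 1) hle x).trans ?_
      exact mul_le_mul_of_nonneg_left ((tvDist_heatKernel_le_dCont P π n x).trans ih) hr0
  obtain ⟨n, hn⟩ := exists_pow_lt_of_lt_one hε hr1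
  exact ⟨n, n.cast_nonneg, (hpow n).trans hn.le⟩

/-! ### Comparison of the two distances -/

lemma dAve_le_dCont_add (h : IsReversibleChain P π) {t l : ℝ} (ht : 0 ≤ t) (hl : 0 < l) (n : ℕ) :
    dAve P π (⌈t + l⌉₊ + 2 * n) ≤ dCont P π t + t / l ^ 2 + (l + 1) / (n + 1) := by
  rw [h.dAve_le_iff]
  intro x f h0 h1
  have h2 := h.sub_averagedKernel_mulVec_le ht hl n h0 h1 x
  linarith [tvDist_heatKernel_le_dCont P π t x]

lemma dCont_le_dAve_add (h : IsReversibleChain P π) {t : ℝ} {k : ℕ} (hkt : (k : ℝ) < t) :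
    dCont P π t ≤ dAve P π k + t / (t - k) ^ 2 + 1 / (4 * √t) := by
  have ht : 0 < t := k.cast_nonneg.trans_lt hkt
  rw [h.dCont_le_iff ht.le]
  intro x f h0 h1
  set a : ℕ → ℝ := fun j => (P ^ j *ᵥ f) x with ha
  have ha0 : ∀ j, 0 ≤ a j := fun j =>
    nonneg_mulVec_of_mem_rowStochastic (h.pow_mem_rowStochastic j) h0 x
  have ha1 : ∀ j, a j ≤ 1 := fun j =>
    mulVec_le_one_of_mem_rowStochastic (h.pow_mem_rowStochastic j) h1 x
  have hs0 : 0 < √t := Real.sqrt_pos.2 ht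
  have hH : HasSum (fun j => poissonWeight t j * a j) ((heatKernel P t *ᵥ f) x) :=
    hasSum_heatKernel_mulVec P t f x
  have hHP : HasSum (fun j => poissonWeight t j * a (j + 1)) ((heatKernel P t *ᵥ (P *ᵥ f)) x) := by
    refine (hasSum_heatKernel_mulVec P t (P *ᵥ f) x).congr_fun fun j => ?_
    rw [mulVec_mulVec, ← pow_succ]
  set S := (heatKernel P t *ᵥ f) x with hS
  set S' := (heatKernel P t *ᵥ (P *ᵥ f)) x with hS'
  have hlow : ∀ j : ℕ, ∑ y, π y * f y - dAve P π k - ((j : ℝ) - t) ^ 2 / (t - k) ^ 2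
      ≤ (a j + a (j + 1)) / 2 := by
    intro j
    by_cases hj : k ≤ j
    · have h2 := h.dAve_le_iff.1 (h.dAve_antitone hj) x f h0 h1
      rw [averagedKernel_mulVec] at h2
      have : 0 ≤ ((j : ℝ) - t) ^ 2 / (t - k) ^ 2 := by positivity
      linarith
    · have h2 : 1 ≤ ((j : ℝ) - t) ^ 2 / (t - k) ^ 2 := by
        rw [le_div_iff₀ (by have := sub_pos.2 hkt; positivity)]
        have : (j : ℝ) ≤ k := by exact_mod_cast (not_le.1 hj).le
        nlinarith
      have h3 : ∑ y, π y * f y ≤ 1 := by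
        rw [← h.distribution.2]
        exact Finset.sum_le_sum fun y _ => mul_le_of_le_one_right (h.distribution.1 y) (h1 y)
      linarith [dAve_nonneg P π k, ha0 j, ha0 (j + 1)]
  have e1 : ∑ y, π y * f y - dAve P π k - t / (t - k) ^ 2 ≤ (S + S') / 2 := by
    have h2 := (((hasSum_poissonWeight t).mul_right (∑ y, π y * f y - dAve P π k)).sub
      ((hasSum_poissonWeight_mul_sq t).div_const ((t - k) ^ 2)))
    rw [one_mul] at h2
    refine hasSum_le (fun j => ?_) h2 ((hH.add hHP).div_const 2)
    have := mul_le_mul_of_nonneg_left (hlow j) (poissonWeight_nonneg ht.le j)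
    calc _ = poissonWeight t j *
          (∑ y, π y * f y - dAve P π k - ((j : ℝ) - t) ^ 2 / (t - k) ^ 2) := by ring
      _ ≤ _ := this
      _ = _ := by ring
  -- By Stein, t(S' - S) = 𝔼[(N - t) a(N)]. Centring a at 1/2 is free since 𝔼[N - t] = 0, and leaves
  -- 𝔼|N - t| / 2 ≤ √t / 2.
  have e2 : S' - S ≤ 1 / (2 * √t) := by
    have h2 := HasSum.poissonWeight_size_bias hHP
    have h3 : HasSum (fun j : ℕ => poissonWeight t j * (j * 1)) (t * 1) :=
      HasSum.poissonWeight_size_bias (a := fun _ => 1) (by simpa using hasSum_poissonWeight t)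
    have h4 := (h2.sub (hH.mul_left t)).sub
      ((h3.sub ((hasSum_poissonWeight t).mul_left t)).mul_left (1 / 2))
    have h5 := (((hasSum_poissonWeight_mul_sq t).div_const (√t)).add
      ((hasSum_poissonWeight t).mul_left (√t))).mul_left (1 / 4)
    have h6 := hasSum_le (fun j => ?_) h4 h5
    · have h7 : t / √t = √t := Real.div_sqrt
      rw [h7] at h6
      have h8 : t * (S' - S) ≤ √t / 2 := by linarith
      have h9 : √t * √t = t := Real.mul_self_sqrt ht.le
      rw [le_div_iff₀ (by positivity)]
      have : √t * (√t * (S' - S)) ≤ √t * (1 / 2) := by rw [← mul_assoc, h9]; linarith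
      have := le_of_mul_le_mul_left this hs0
      linarith
    · have hp := poissonWeight_nonneg ht.le j
      have h7 : ((j : ℝ) - t) * (a j - 1 / 2) ≤ 1 / 4 * (((j : ℝ) - t) ^ 2 / √t + √t) := by
        have h8 : |(j : ℝ) - t| * 2 ≤ ((j : ℝ) - t) ^ 2 / √t + √t := by
          rw [div_add' _ _ _ hs0.ne', le_div_iff₀ hs0]
          nlinarith [sq_nonneg (|(j : ℝ) - t| - √t), sq_abs ((j : ℝ) - t)]
        have h9 : ((j : ℝ) - t) * (a j - 1 / 2) ≤ |(j : ℝ) - t| * (1 / 2) := by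
          refine (le_abs_self _).trans ?_
          rw [abs_mul]
          refine mul_le_mul_of_nonneg_left ?_ (abs_nonneg _)
          rw [abs_le]
          constructor <;> linarith [ha0 j, ha1 j]
        linarith
      have := mul_le_mul_of_nonneg_left h7 hp
      calc _ = poissonWeight t j * (((j : ℝ) - t) * (a j - 1 / 2)) := by ring
        _ ≤ _ := this
        _ = _ := by ring
  have e3 : 1 / (4 * √t) = 1 / (2 * √t) / 2 := by field_simp; norm_num
  rw [e3]
  linarith

/-- H_s and H_t mix the same powers of P with different Poisson weights, so they differ no more than
the weights do. The linear AM-GM form of the χ² bound avoids a square root; its 1/8 is small enough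
for levels 1/2 and 1/4. -/
lemma dCont_le_dCont_add (h : IsReversibleChain P π) {s t : ℝ} (hs : 0 ≤ s) (ht : 0 < t) :
    dCont P π s ≤ dCont P π t + 1 / 8 + (Real.exp ((t - s) ^ 2 / t) - 1) / 2 := by
  rw [h.dCont_le_iff hs]
  intro x f h0 h1
  have h2 := (h.dCont_le_iff ht.le).1 le_rfl x f h0 h1
  set a : ℕ → ℝ := fun j => (P ^ j *ᵥ f) x with ha
  have ha0 : ∀ j, 0 ≤ a j := fun j =>
    nonneg_mulVec_of_mem_rowStochastic (h.pow_mem_rowStochastic j) h0 x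
  have ha1 : ∀ j, a j ≤ 1 := fun j =>
    mulVec_le_one_of_mem_rowStochastic (h.pow_mem_rowStochastic j) h1 x
  have h3 := ((hasSum_heatKernel_mulVec P t f x).sub (hasSum_heatKernel_mulVec P s f x)).sub
    (((hasSum_poissonWeight t).sub (hasSum_poissonWeight s)).mul_left (1 / 2))
  have h4 := ((hasSum_poissonWeight t).mul_left (1 / 8)).add
    ((hasSum_poissonWeight_ratio (s := s) ht).div_const 2)
  have h5 := hasSum_le (fun j => ?_) h3 h4
  · linarith
  · have hp := poissonWeight_pos ht j
    set p := poissonWeight t j with hpdef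
    set q := poissonWeight s j with hqdef
    have h6 : |p - q| ≤ 1 / 4 * p + (q - p) ^ 2 / p := by
      rw [← sub_le_iff_le_add', le_div_iff₀ hp]
      nlinarith [sq_nonneg (|p - q| - 1 / 2 * p), sq_abs (p - q)]
    have h7 : (p - q) * (a j - 1 / 2) ≤ |p - q| * (1 / 2) := by
      refine (le_abs_self _).trans ?_
      rw [abs_mul]
      refine mul_le_mul_of_nonneg_left ?_ (abs_nonneg _)
      rw [abs_le]
      constructor <;> linarith [ha0 j, ha1 j]
    calc _ = (p - q) * (a j - 1 / 2) := by simp only [ha]; ring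
      _ ≤ _ := by linarith

/-- If at time `k` the averaged chain is far from equilibrium, then it is still at distance
about `1/2` one step later. -/
lemma lt_dAve_succ (h : IsReversibleChain P π) {k : ℕ} {η : ℝ} (hk : 1 - η < dAve P π k) :
    1 / 2 - 3 * η < dAve P π (k + 1) := by
  by_contra! hcon
  rw [h.dAve_le_iff] at hcon
  refine hk.not_ge (h.dAve_le_iff.2 fun x f h0 h1 => ?_)
  have h2 := hcon x f h0 h1
  rw [averagedKernel_mulVec] at h2 ⊢
  -- The averages at k and k + 1 share P^{k+1}: closeness at k + 1 bounds its value below, giving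
  -- the bound 1 - 3η at k. The trivial bound 1, taken with weight 2/3, yields 1 - η for either sign
  -- of η.
  have b1 := mulVec_le_one_of_mem_rowStochastic (h.pow_mem_rowStochastic (k + 1 + 1)) h1 x
  have b2 := mulVec_le_one_of_mem_rowStochastic (h.pow_mem_rowStochastic (k + 1)) h1 x
  have b3 := nonneg_mulVec_of_mem_rowStochastic (h.pow_mem_rowStochastic k) h0 x
  have b4 := nonneg_mulVec_of_mem_rowStochastic (h.pow_mem_rowStochastic (k + 1)) h0 x
  have b5 : ∑ y, π y * f y ≤ 1 := by
    rw [← h.distribution.2]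
    exact Finset.sum_le_sum fun y _ => mul_le_of_le_one_right (h.distribution.1 y) (h1 y)
  linarith

lemma one_half_le_dCont_zero (h : IsReversibleChain P π) [Nontrivial Ω] :
    1 / 2 ≤ dCont P π 0 := by
  obtain ⟨x, y, hxy⟩ := exists_pair_ne Ω
  have h1 : π x + π y ≤ 1 := by
    rw [← h.distribution.2, ← Finset.sum_pair hxy]
    exact Finset.sum_le_sum_of_subset_of_nonneg (Finset.subset_univ _) fun z _ _ =>
      h.distribution.1 z
  have key : ∀ z, 1 - π z ≤ dCont P π 0 := by
    intro z
    have := (h.dCont_le_iff le_rfl).1 le_rfl z (fun w => if w = z then 0 else 1)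
      (fun w => by split_ifs <;> norm_num) (fun w => by split_ifs <;> norm_num)
    rw [heatKernel_zero, one_mulVec] at this
    have h2 : ∑ w, π w * (if w = z then (0 : ℝ) else 1) = 1 - π z := by
      have h3 : ∀ w, π w * (if w = z then (0 : ℝ) else 1) = π w - if w = z then π w else 0 :=
        fun w => by split_ifs <;> ring
      simp only [h3, Finset.sum_sub_distrib, h.distribution.2]
      simp
    rw [h2] at this
    simpa using this
  linarith [key x, key y]

lemma dCont_eq_zero (h : IsReversibleChain P π) [Subsingleton Ω] {t : ℝ} (ht : 0 ≤ t) :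
    dCont P π t = 0 := by
  refine le_antisymm ((h.dCont_le_iff ht).2 fun x f _ _ => ?_) (dCont_nonneg _ _ _)
  have hf : f = f x • (1 : Ω → ℝ) := by ext y; simp [Subsingleton.elim y x]
  rw [hf, mulVec_smul, (h.heatKernel_mem ht).2]
  simp [← Finset.sum_mul, h.distribution.2]

lemma dAve_eq_zero (h : IsReversibleChain P π) [Subsingleton Ω] (k : ℕ) :
    dAve P π k = 0 := by
  refine le_antisymm (h.dAve_le_iff.2 fun x f _ _ => ?_) (dAve_nonneg _ _ _)
  have hf : f = f x • (1 : Ω → ℝ) := by ext y; simp [Subsingleton.elim y x]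
  rw [hf, mulVec_smul, (h.averagedKernel_mem k).2]
  simp [← Finset.sum_mul, h.distribution.2]

end IsReversibleChain

/-! ### Mixing times -/

section MixingTime

variable {Ω : Type*} [Fintype Ω] [DecidableEq Ω]

lemma tCont_nonneg (P : Matrix Ω Ω ℝ) (π : Ω → ℝ) (ε : ℝ) : 0 ≤ tCont P π ε :=
  Real.sInf_nonneg fun _ ht => ht.1

lemma tCont_le {P : Matrix Ω Ω ℝ} {π : Ω → ℝ} {ε t : ℝ} (ht : 0 ≤ t) (hd : dCont P π t ≤ ε) :
    tCont P π ε ≤ t :=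
  csInf_le ⟨0, fun _ hs => hs.1⟩ ⟨ht, hd⟩

lemma tAve_le {P : Matrix Ω Ω ℝ} {π : Ω → ℝ} {ε : ℝ} {k : ℕ} (hd : dAve P π k ≤ ε) :
    tAve P π ε ≤ k :=
  Nat.sInf_le hd

end MixingTime

namespace IsReversibleChain

/-- The averaged chain is almost as close to equilibrium as the continuous-time chain was `O(√t)`
steps earlier. -/
lemma exists_const_dAve_le.{u} {δ : ℝ} (hδ : 0 < δ) :
    ∃ C : ℝ, 0 < C ∧ ∀ {Ω : Type u} [Fintype Ω] [DecidableEq Ω] {P : Matrix Ω Ω ℝ} {π : Ω → ℝ},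
      IsReversibleChain P π → ∀ t : ℝ, 0 ≤ t →
        ∃ k : ℕ, (k : ℝ) ≤ t + C * (√t + 1) ∧ dAve P π k ≤ dCont P π t + δ := by
  -- With l = c(√t + 1), Chebyshev's error is at most 1 / c² ≤ δ / 2.
  set c : ℝ := 2 / δ + 1 with hc
  have hc1 : 1 ≤ c := by rw [hc]; linarith [show 0 < 2 / δ by positivity]
  have hcδ : 1 / c ^ 2 ≤ δ / 2 := by
    have h1 : 1 / c ≤ δ / 2 := by
      rw [div_le_div_iff₀ (by positivity) two_pos, hc]
      have : δ * (2 / δ) = 2 := by field_simp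
      nlinarith
    refine le_trans ?_ h1
    exact one_div_le_one_div_of_le (by positivity) (by nlinarith)
  refine ⟨c + 3 + 4 * (c + 1) / δ, by positivity, fun {Ω} _ _ {P π} h t ht => ?_⟩
  set R := √t + 1 with hR
  have hst := Real.sqrt_nonneg t
  have hR1 : 1 ≤ R := by linarith
  -- A burn-in this long makes the regularity error (l + 1) / (n + 1) at most δ / 2.
  set n := ⌈2 * (c * R + 1) / δ⌉₊ with hn
  refine ⟨⌈t + c * R⌉₊ + 2 * n, ?_, ?_⟩
  · have h1 := Nat.ceil_lt_add_one (show 0 ≤ t + c * R by positivity)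
    have h2 := Nat.ceil_lt_add_one (show 0 ≤ 2 * (c * R + 1) / δ by positivity)
    have h3 : 2 * (c * R + 1) / δ ≤ 2 * (c + 1) / δ * R := by
      rw [div_mul_eq_mul_div]
      refine div_le_div_of_nonneg_right ?_ hδ.le
      nlinarith
    have h4 : 4 * (c + 1) / δ = 2 * (2 * (c + 1) / δ) := by ring
    rw [h4]
    push_cast
    nlinarith
  · have h1 := h.dAve_le_dCont_add ht (l := c * R) (by positivity) n
    have h2 : t / (c * R) ^ 2 ≤ δ / 2 := by
      refine le_trans ?_ hcδ
      rw [div_le_div_iff₀ (by positivity) (by positivity), mul_pow]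
      have : t ≤ R ^ 2 := by nlinarith [Real.sq_sqrt ht]
      nlinarith [sq_nonneg c]
    have h3 : (c * R + 1) / (n + 1) ≤ δ / 2 := by
      rw [div_le_div_iff₀ (by positivity) two_pos]
      have h4 := Nat.le_ceil (2 * (c * R + 1) / δ)
      rw [div_le_iff₀ hδ] at h4
      nlinarith
    linarith

/-- The continuous-time chain is almost as close to equilibrium as the averaged chain was `O(√k)`
steps earlier. -/
lemma exists_const_dCont_le.{u} {δ : ℝ} (hδ : 0 < δ) :
    ∃ C : ℝ, 0 < C ∧ ∀ {Ω : Type u} [Fintype Ω] [DecidableEq Ω] {P : Matrix Ω Ω ℝ} {π : Ω → ℝ},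
      IsReversibleChain P π → ∀ k : ℕ,
        dCont P π (k + C * (√k + 1)) ≤ dAve P π k + δ := by
  -- The term 4 / δ serves Chebyshev's error, at most 2 / C. The term (1 / δ)² makes √t ≥ 1 / δ,
  -- which serves Stein's error.
  set C : ℝ := 4 / δ + (1 / δ) ^ 2 + 1 with hC
  have hδ4 : 0 < 4 / δ := by positivity
  have hδ1 : 0 < 1 / δ := by positivity
  have hC1 : 1 ≤ C := by rw [hC]; nlinarith
  refine ⟨C, by linarith, fun {Ω} _ _ {P π} h k => ?_⟩
  set R := √(k : ℝ) + 1 with hR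
  have hst := Real.sqrt_nonneg (k : ℝ)
  have hR1 : 1 ≤ R := by linarith
  have hk0 : (0 : ℝ) ≤ k := k.cast_nonneg
  have hCR : C ≤ C * R := le_mul_of_one_le_right (by linarith) hR1
  have h1 := h.dCont_le_dAve_add (t := k + C * R) (k := k) (by linarith)
  rw [add_sub_cancel_left] at h1
  have h2 : (k + C * R) / (C * R) ^ 2 ≤ δ / 2 := by
    have hkR : (k : ℝ) ≤ R ^ 2 := by nlinarith [Real.sq_sqrt hk0]
    have e1 : (k + C * R) / (C * R) ^ 2 ≤ 2 / C := by
      rw [div_le_div_iff₀ (by positivity) (by positivity)]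
      have e3 : (k : ℝ) ≤ C * R ^ 2 := by nlinarith [sq_nonneg R]
      have e4 : C * R ≤ C * R ^ 2 := by nlinarith
      nlinarith
    have e2 : 2 / C ≤ δ / 2 := by
      rw [div_le_div_iff₀ (by positivity) two_pos]
      have : δ * (4 / δ) = 4 := by field_simp
      rw [hC]
      nlinarith [mul_nonneg hδ.le (sq_nonneg (1 / δ))]
    exact e1.trans e2
  have h3 : 1 / (4 * √(k + C * R)) ≤ δ / 4 := by
    have e1 : 1 / δ ≤ √(k + C * R) := by
      refine Real.le_sqrt_of_sq_le ?_
      linarith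
    rw [div_le_iff₀ hδ] at e1
    rw [div_le_div_iff₀ (by nlinarith) (by norm_num)]
    linarith
  linarith

variable {Ω : Type*} [Fintype Ω] [DecidableEq Ω] {P : Matrix Ω Ω ℝ} {π : Ω → ℝ}

lemma dCont_le_of_tCont_lt (h : IsReversibleChain P π) {ε t : ℝ} (hε : 0 < ε)
    (ht : tCont P π ε < t) : dCont P π t ≤ ε := by
  obtain ⟨s, ⟨-, hs⟩, hst⟩ := exists_lt_of_csInf_lt (h.exists_dCont_le hε) ht
  exact (h.dCont_anti hst.le).trans hs

lemma exists_dAve_le (h : IsReversibleChain P π) {ε : ℝ} (hε : 0 < ε) :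
    ∃ k, dAve P π k ≤ ε := by
  obtain ⟨t, ht, hd⟩ := h.exists_dCont_le (half_pos hε)
  obtain ⟨C, -, hC⟩ := exists_const_dAve_le (half_pos hε)
  obtain ⟨k, -, hk⟩ := hC h t ht
  exact ⟨k, by linarith⟩

lemma dAve_tAve_le (h : IsReversibleChain P π) {ε : ℝ} (hε : 0 < ε) :
    dAve P π (tAve P π ε) ≤ ε :=
  Nat.sInf_mem (s := {k | dAve P π k ≤ ε}) (h.exists_dAve_le hε)

lemma tCont_anti (h : IsReversibleChain P π) {ε ε' : ℝ} (hε : 0 < ε) (hle : ε ≤ ε') :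
    tCont P π ε' ≤ tCont P π ε :=
  csInf_le_csInf ⟨0, fun _ hs => hs.1⟩ (h.exists_dCont_le hε) fun _ ht => ⟨ht.1, ht.2.trans hle⟩

lemma tAve_anti (h : IsReversibleChain P π) {ε ε' : ℝ} (hε : 0 < ε) (hle : ε ≤ ε') :
    tAve P π ε' ≤ tAve P π ε :=
  tAve_le ((h.dAve_tAve_le hε).trans hle)

lemma tCont_eq_zero (h : IsReversibleChain P π) [Subsingleton Ω] {ε : ℝ} (hε : 0 < ε) :
    tCont P π ε = 0 :=
  le_antisymm (tCont_le le_rfl ((h.dCont_eq_zero le_rfl).trans_le hε.le)) (tCont_nonneg _ _ _)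

lemma tAve_eq_zero (h : IsReversibleChain P π) [Subsingleton Ω] {ε : ℝ} (hε : 0 < ε) :
    tAve P π ε = 0 :=
  Nat.le_zero.1 (tAve_le ((h.dAve_eq_zero 0).trans_le hε.le))

/-- The drop from 1/2 to 1/4 forces exp u ≥ 5/4 for u = (t - s)² / t, hence u ≥ 1 - 4/5. -/
lemma div_five_le_sq_sub (h : IsReversibleChain P π) {s t : ℝ} (hs : 0 ≤ s) (ht : 0 < t)
    (hds : 1 / 2 ≤ dCont P π s) (hdt : dCont P π t ≤ 1 / 4) : t / 5 ≤ (t - s) ^ 2 := by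
  have h1 := h.dCont_le_dCont_add hs ht
  set u := (t - s) ^ 2 / t with hu
  have h2 : 5 / 4 ≤ Real.exp u := by linarith
  have h3 : 1 - u ≤ Real.exp (-u) := Real.one_sub_le_exp_neg u
  have h4 : Real.exp u * Real.exp (-u) = 1 := by rw [← Real.exp_add]; simp
  have h5 : 1 / 5 ≤ u := by
    by_contra! h6
    nlinarith [Real.exp_pos u]
  rw [hu, le_div_iff₀ ht] at h5
  linarith

lemma one_fifth_le_tCont (h : IsReversibleChain P π) [Nontrivial Ω] :
    1 / 5 ≤ tCont P π (1 / 4) := by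
  refine le_of_forall_pos_le_add fun η hη => ?_
  have h0 := tCont_nonneg P π (1 / 4)
  have h1 := h.div_five_le_sq_sub le_rfl (t := tCont P π (1 / 4) + η) (by linarith)
    h.one_half_le_dCont_zero (h.dCont_le_of_tCont_lt (by norm_num) (by linarith))
  have h2 : 0 < tCont P π (1 / 4) + η := by linarith
  by_contra! h3
  nlinarith

/-- The total variation window of a continuous-time chain is at least of order `√T`. -/
lemma sqrt_tCont_le (h : IsReversibleChain P π) :
    √(tCont P π (1 / 4)) ≤ 3 * (tCont P π (1 / 4) - tCont P π (3 / 4)) := by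
  rcases subsingleton_or_nontrivial Ω with hΩ | hΩ
  · rw [h.tCont_eq_zero (by norm_num), h.tCont_eq_zero (by norm_num)]
    simp
  have hle : tCont P π (3 / 4) ≤ tCont P π (1 / 4) := h.tCont_anti (by norm_num) (by norm_num)
  have hs0 := tCont_nonneg P π (3 / 4)
  set T := tCont P π (1 / 4) with hT
  set s := tCont P π (3 / 4) with hs
  have key : ∀ η : ℝ, 0 < η → (T + η) / 5 ≤ (T - s + 2 * η) ^ 2 := by
    intro η hη
    -- Moving out by η on both sides avoids asking whether the infima are attained. If s - η is
    -- negative, time 0 serves, where the distance is already at least 1/2.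
    have h1 := h.div_five_le_sq_sub (s := max 0 (s - η)) (t := T + η) (le_max_left _ _)
      (by linarith) ?_ (h.dCont_le_of_tCont_lt (by norm_num) (by linarith))
    · refine h1.trans (pow_le_pow_left₀ (sub_nonneg.2 (max_le ?_ ?_)) ?_ 2)
      · linarith
      · linarith
      · linarith [le_max_right 0 (s - η)]
    · rcases le_total (s - η) 0 with hsη | hsη
      · rw [max_eq_left hsη]; exact h.one_half_le_dCont_zero
      · rw [max_eq_right hsη]
        by_contra! hlt
        have := tCont_le (P := P) (π := π) (ε := 3 / 4) hsη (by linarith)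
        linarith
  have hlim : T / 5 ≤ (T - s) ^ 2 := by
    have c1 : Tendsto (fun η : ℝ => (T + η) / 5) (nhdsWithin 0 (Set.Ioi 0)) (nhds (T / 5)) := by
      have : Continuous fun η : ℝ => (T + η) / 5 := by fun_prop
      simpa using (this.tendsto 0).mono_left nhdsWithin_le_nhds
    have c2 : Tendsto (fun η : ℝ => (T - s + 2 * η) ^ 2) (nhdsWithin 0 (Set.Ioi 0))
        (nhds ((T - s) ^ 2)) := by
      have : Continuous fun η : ℝ => (T - s + 2 * η) ^ 2 := by fun_prop
      simpa using (this.tendsto 0).mono_left nhdsWithin_le_nhds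
    exact le_of_tendsto_of_tendsto c1 c2 (eventually_mem_nhdsWithin.mono key)
  rw [Real.sqrt_le_iff]
  constructor
  · linarith
  · nlinarith

/-- This absorbs additive constants into multiples of √T. One-point chains, with T = 0, are treated
apart. -/
lemma one_le_three_mul_sqrt_tCont (h : IsReversibleChain P π) [Nontrivial Ω] :
    1 ≤ 3 * √(tCont P π (1 / 4)) := by
  have : 1 / 3 ≤ √(tCont P π (1 / 4)) :=
    Real.le_sqrt_of_sq_le (by linarith [h.one_fifth_le_tCont])
  linarith

lemma sqrt_tCont_le_three_mul (h : IsReversibleChain P π) :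
    √(tCont P π (1 / 4)) ≤ 3 * tCont P π (1 / 4) := by
  linarith [h.sqrt_tCont_le, tCont_nonneg P π (3 / 4)]

/-- By submultiplicativity j further periods of length 2T bring the distance below 2^{-j}. The
constant precedes the chain, so it is uniform along a sequence. -/
lemma exists_const_tCont_le.{u} {ε : ℝ} (hε : 0 < ε) :
    ∃ M : ℝ, 0 < M ∧ ∀ {Ω : Type u} [Fintype Ω] [DecidableEq Ω] {P : Matrix Ω Ω ℝ} {π : Ω → ℝ},
      IsReversibleChain P π → tCont P π ε ≤ M * tCont P π (1 / 4) := by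
  obtain ⟨j, hj⟩ := exists_pow_lt_of_lt_one hε (show (1 / 2 : ℝ) < 1 by norm_num)
  refine ⟨2 * j + 1, by positivity, fun {Ω} _ _ {P π} h => ?_⟩
  rcases subsingleton_or_nontrivial Ω with hΩ | hΩ
  · rw [h.tCont_eq_zero hε, h.tCont_eq_zero (by norm_num), mul_zero]
  have hT := h.one_fifth_le_tCont
  set T := tCont P π (1 / 4) with hTdef
  have h1 := h.dCont_nat_mul_le (t := 2 * T) (by linarith)
    (h.dCont_le_of_tCont_lt (by norm_num) (by linarith)) j
  have h2 := tCont_le (ε := ε) (P := P) (π := π) (by positivity) (h1.trans hj.le)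
  linarith

lemma exists_const_tAve_le_tCont_add.{u} {ε ε' : ℝ} (hε' : 0 < ε') (hlt : ε' < ε) :
    ∃ C : ℝ, 0 < C ∧ ∀ {Ω : Type u} [Fintype Ω] [DecidableEq Ω] {P : Matrix Ω Ω ℝ} {π : Ω → ℝ},
      IsReversibleChain P π → (tAve P π ε : ℝ) ≤ tCont P π ε' + C * √(tCont P π (1 / 4)) := by
  obtain ⟨C, hC, hA⟩ := exists_const_dAve_le.{u} (sub_pos.2 hlt)
  obtain ⟨M, hM, hMT⟩ := exists_const_tCont_le.{u} hε'
  refine ⟨3 + C * (√(M + 5) + 3), by positivity, fun {Ω} _ _ {P π} h => ?_⟩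
  rcases subsingleton_or_nontrivial Ω with hΩ | hΩ
  · rw [h.tCont_eq_zero hε', h.tAve_eq_zero (hε'.trans hlt), h.tCont_eq_zero (by norm_num)]
    simp
  have h0 := tCont_nonneg P π ε'
  obtain ⟨k, hk, hd⟩ := hA h (tCont P π ε' + 1) (by linarith)
  have hd' := h.dCont_le_of_tCont_lt hε' (lt_add_one _)
  have hle : (tAve P π ε : ℝ) ≤ k := by exact_mod_cast tAve_le (by linarith)
  have h1 := h.one_le_three_mul_sqrt_tCont
  have h2 : √(tCont P π ε' + 1) ≤ √(M + 5) * √(tCont P π (1 / 4)) := by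
    rw [← Real.sqrt_mul (by positivity)]
    refine Real.sqrt_le_sqrt ?_
    linarith [hMT h, h.one_fifth_le_tCont]
  have h3 : C * (√(tCont P π ε' + 1) + 1)
      ≤ C * (√(M + 5) * √(tCont P π (1 / 4)) + 3 * √(tCont P π (1 / 4))) := by gcongr
  linarith

lemma exists_const_tAve_le.{u} {ε : ℝ} (hε : 0 < ε) :
    ∃ M : ℝ, 0 < M ∧ ∀ {Ω : Type u} [Fintype Ω] [DecidableEq Ω] {P : Matrix Ω Ω ℝ} {π : Ω → ℝ},
      IsReversibleChain P π → (tAve P π ε : ℝ) ≤ M * tCont P π (1 / 4) := by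
  obtain ⟨C, hC, hA⟩ := exists_const_tAve_le_tCont_add.{u} (half_pos hε) (half_lt_self hε)
  obtain ⟨M, hM, hMT⟩ := exists_const_tCont_le.{u} (half_pos hε)
  refine ⟨M + 3 * C, by positivity, fun {Ω} _ _ {P π} h => ?_⟩
  nlinarith [hA h, hMT h, h.sqrt_tCont_le_three_mul]

/-- The √T form is compared with windows. The form in `tAve` alone is kept for bounding T by `tAve`.
-/
lemma exists_const_tCont_le_tAve_add.{u} {ε ε' : ℝ} (hε' : 0 < ε') (hlt : ε' < ε) :
    ∃ C : ℝ, 0 < C ∧ ∀ {Ω : Type u} [Fintype Ω] [DecidableEq Ω] {P : Matrix Ω Ω ℝ} {π : Ω → ℝ},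
      IsReversibleChain P π →
        tCont P π ε ≤ tAve P π ε' + C * (√(tAve P π ε' : ℝ) + 1) ∧
        tCont P π ε ≤ tAve P π ε' + C * √(tCont P π (1 / 4)) := by
  obtain ⟨C, hC, hB⟩ := exists_const_dCont_le.{u} (sub_pos.2 hlt)
  obtain ⟨M, hM, hMT⟩ := exists_const_tAve_le.{u} hε'
  refine ⟨C * (√M + 3) , by positivity, fun {Ω} _ _ {P π} h => ?_⟩
  have hb : tCont P π ε ≤ tAve P π ε' + C * (√(tAve P π ε' : ℝ) + 1) := by
    refine tCont_le (by positivity) ((hB h _).trans ?_)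
    linarith [h.dAve_tAve_le hε']
  have hM0 := Real.sqrt_nonneg M
  have hle : C * (√(tAve P π ε' : ℝ) + 1) ≤ C * (√M + 3) * (√(tAve P π ε' : ℝ) + 1) := by
    refine mul_le_mul_of_nonneg_right ?_ (by positivity)
    nlinarith
  refine ⟨hb.trans (by linarith), ?_⟩
  rcases subsingleton_or_nontrivial Ω with hΩ | hΩ
  · rw [h.tCont_eq_zero (hε'.trans hlt), h.tAve_eq_zero hε', h.tCont_eq_zero (by norm_num)]
    simp
  have h2 : √(tAve P π ε' : ℝ) ≤ √M * √(tCont P π (1 / 4)) := by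
    rw [← Real.sqrt_mul hM.le]
    exact Real.sqrt_le_sqrt (hMT h)
  have h3 : C * (√(tAve P π ε' : ℝ) + 1)
      ≤ C * (√M * √(tCont P π (1 / 4)) + 3 * √(tCont P π (1 / 4))) := by
    gcongr
    exact h.one_le_three_mul_sqrt_tCont
  linarith

/-- One step cannot bring the distance from above 15/16 to below 1/2 - 3/16 = 5/16. If the upper
level is met at time 0 there is no earlier step, and positivity of the 1/4-mixing time is used
instead. -/
lemma tAve_lt_tAve (h : IsReversibleChain P π) (h0 : 0 < tAve P π (1 / 4)) :
    tAve P π (15 / 16) < tAve P π (1 / 16) := by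
  rcases Nat.eq_zero_or_pos (tAve P π (15 / 16)) with hz | hpos
  · rw [hz]
    exact h0.trans_le (h.tAve_anti (by norm_num) (by norm_num))
  · obtain ⟨j, hj⟩ := Nat.exists_eq_succ_of_ne_zero hpos.ne'
    have h1 : 1 - 1 / 16 < dAve P π j := by
      by_contra! hle
      have := tAve_le (ε := 15 / 16) (hle.trans (by norm_num))
      lia
    have h2 := h.lt_dAve_succ h1
    by_contra! hle
    have h3 := h.dAve_antitone hle
    have h4 := h.dAve_tAve_le (ε := 1 / 16) (by norm_num)
    rw [hj, Nat.succ_eq_add_one] at h3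
    linarith

end IsReversibleChain

/-! ### Cutoff -/

section Cutoff

open IsReversibleChain

variable {Ω : ℕ → Type*} [∀ n, Fintype (Ω n)] [∀ n, DecidableEq (Ω n)]
    {P : ∀ n, Matrix (Ω n) (Ω n) ℝ} {π : ∀ n, Ω n → ℝ} {w : ℕ → ℝ}

/-- A continuous-time cutoff window is at least of order `√T`. -/
lemma ContCutoffWithWindow.sqrt_le (hchain : ∀ n, IsReversibleChain (P n) (π n))
    (hcut : ContCutoffWithWindow P π w) :
    ∃ C : ℝ, 0 < C ∧ ∀ n, √(tCont (P n) (π n) (1 / 4)) ≤ C * w n ∧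
      tCont (P n) (π n) (1 / 4) - tCont (P n) (π n) (3 / 4) ≤ C * w n := by
  obtain ⟨C, hC, h⟩ := hcut.2 (1 / 4) (by norm_num) le_rfl
  refine ⟨3 * C, by positivity, fun n => ?_⟩
  have h1 := h n
  rw [show (1 - 1 / 4 : ℝ) = 3 / 4 by norm_num] at h1
  have h2 := (hchain n).sqrt_tCont_le
  have h3 := Real.sqrt_nonneg (tCont (P n) (π n) (1 / 4))
  constructor <;> linarith

/-- Cutoff makes `tCont (3/4)` at least T / 2, and `tCont (3/4)` ≤ `tCont (3/8)` is bounded through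
the averaged time at the lower level 1/4. -/
lemma ContCutoffWithWindow.tCont_isBigO (hchain : ∀ n, IsReversibleChain (P n) (π n))
    (hcut : ContCutoffWithWindow P π w) :
    (fun n => tCont (P n) (π n) (1 / 4)) =O[atTop]
      (fun n => (tAve (P n) (π n) (1 / 4) : ℝ)) := by
  obtain ⟨C₀, hC₀, hw⟩ := hcut.sqrt_le hchain
  obtain ⟨C, hC, hB⟩ := exists_const_tCont_le_tAve_add (ε := 3 / 8) (ε' := 1 / 4)
    (by norm_num) (by norm_num)
  refine IsBigO.of_bound (4 * (1 + C)) ?_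
  -- Since √T ≤ C₀ w, this smallness gives T = 0 or T ≥ 8C + 2, so the additive error 4C in T ≤ 2(1
  -- + C)a + 4C is at most T / 2.
  have hsmall := (isLittleO_iff.1 hcut.1) (show 0 < 1 / (C₀ * (8 * C + 2)) by positivity)
  filter_upwards [hsmall] with n hn
  have h0 := tCont_nonneg (P n) (π n) (1 / 4)
  obtain ⟨h1, h2⟩ := hw n
  have hB := (hB (hchain n)).1
  have h3 : tCont (P n) (π n) (3 / 4) ≤ tCont (P n) (π n) (3 / 8) :=
    (hchain n).tCont_anti (by norm_num) (by norm_num)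
  set T := tCont (P n) (π n) (1 / 4)
  set a : ℝ := (tAve (P n) (π n) (1 / 4) : ℝ)
  have ha : 0 ≤ a := Nat.cast_nonneg _
  rw [Real.norm_of_nonneg h0] at hn ⊢
  rw [Real.norm_of_nonneg ha]
  have h4 : C₀ * w n * (8 * C + 2) ≤ T := by
    have := (le_abs_self _).trans hn
    rw [one_div_mul_eq_div, le_div_iff₀ (by positivity)] at this
    linarith
  have hsq := Real.sq_sqrt h0
  have hsa := Real.sq_sqrt ha
  have h5 : √a ≤ a + 1 := by nlinarith [sq_nonneg (√a - 1), Real.sqrt_nonneg a]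
  have h6 : 2 * (T - tCont (P n) (π n) (3 / 4)) ≤ T := by
    have : 0 ≤ C₀ * w n := (Real.sqrt_nonneg T).trans h1
    nlinarith
  rcases h0.eq_or_lt with hT | hT
  · rw [← hT]; positivity
  have h7 : 8 * C + 2 ≤ √T := by
    have hs := Real.sqrt_pos.2 hT
    have : (8 * C + 2) * √T ≤ √T * √T := by
      rw [← sq, hsq]
      nlinarith
    exact le_of_mul_le_mul_right this hs
  have h8 : 8 * C + 2 ≤ T := by nlinarith
  nlinarith

lemma ContCutoffWithWindow.aveCutoffWithWindow (hchain : ∀ n, IsReversibleChain (P n) (π n))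
    (hcut : ContCutoffWithWindow P π w) : AveCutoffWithWindow P π w := by
  refine ⟨hcut.1.trans_isBigO (hcut.tCont_isBigO hchain), fun ε hε hε4 => ?_⟩
  obtain ⟨C₀, hC₀, hw⟩ := hcut.sqrt_le hchain
  -- Each comparison costs ε / 2 in level, so the hypothesis is used at ε / 2.
  obtain ⟨C₁, hC₁, h₁⟩ := exists_const_tAve_le_tCont_add (half_pos hε) (half_lt_self hε)
  obtain ⟨C₂, hC₂, h₂⟩ := exists_const_tCont_le_tAve_add (ε := 1 - ε / 2) (ε' := 1 - ε)
    (by linarith) (by linarith)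
  obtain ⟨C₃, hC₃, h₃⟩ := hcut.2 (ε / 2) (half_pos hε) (by linarith)
  refine ⟨C₃ + (C₁ + C₂) * C₀, by positivity, fun n => ?_⟩
  have e : (C₁ + C₂) * √(tCont (P n) (π n) (1 / 4)) ≤ (C₁ + C₂) * (C₀ * w n) :=
    mul_le_mul_of_nonneg_left (hw n).1 (by positivity)
  linarith [h₁ (hchain n), (h₂ (hchain n)).2, h₃ n]

/-- Integer times differ by at least 1 between levels 15/16 and 1/16, so w ≥ 1 / C eventually. As w
= o(`tAve`) and `tAve` ≤ M T, this forces T → ∞. -/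
lemma AveCutoffWithWindow.sqrt_isLittleO (hchain : ∀ n, IsReversibleChain (P n) (π n))
    (hpos : ∀ᶠ n in atTop, 0 < tAve (P n) (π n) (1 / 4)) (hcut : AveCutoffWithWindow P π w) :
    (fun n => √(tCont (P n) (π n) (1 / 4))) =o[atTop]
      (fun n => tCont (P n) (π n) (1 / 4)) := by
  obtain ⟨C, hC, h⟩ := hcut.2 (1 / 16) (by norm_num) (by norm_num)
  obtain ⟨M, hM, hMT⟩ := exists_const_tAve_le (ε := 1 / 4) (by norm_num)
  rw [isLittleO_iff]
  intro c hc
  have hsmall := (isLittleO_iff.1 hcut.1) (show 0 < c ^ 2 / (C * M) by positivity)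
  filter_upwards [hsmall, hpos] with n hn hpos
  have h0 := tCont_nonneg (P n) (π n) (1 / 4)
  have h1 := h n
  rw [show (1 - 1 / 16 : ℝ) = 15 / 16 by norm_num] at h1
  have h2 : (tAve (P n) (π n) (15 / 16) : ℝ) + 1 ≤ tAve (P n) (π n) (1 / 16) := by
    exact_mod_cast (hchain n).tAve_lt_tAve hpos
  have h3 := hMT (hchain n)
  set T := tCont (P n) (π n) (1 / 4)
  rw [Real.norm_of_nonneg (Real.sqrt_nonneg _), Real.norm_of_nonneg h0]
  rw [Real.norm_of_nonneg (Nat.cast_nonneg _)] at hn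
  have h4 : 1 ≤ c ^ 2 * T := by
    have e1 : w n ≤ c ^ 2 / (C * M) * (M * T) :=
      ((le_abs_self _).trans hn).trans (mul_le_mul_of_nonneg_left h3 (by positivity))
    have e2 : C * (c ^ 2 / (C * M) * (M * T)) = c ^ 2 * T := by field_simp
    have e3 := mul_le_mul_of_nonneg_left e1 hC.le
    linarith
  have hsq := Real.sq_sqrt h0
  have h5 : 1 ≤ c * √T := by
    refine (sq_le_sq₀ zero_le_one (by positivity)).1 ?_
    rw [mul_pow, hsq]
    linarith
  nlinarith [Real.sqrt_nonneg T]

lemma AveCutoffWithWindow.contCutoffWithWindow (hchain : ∀ n, IsReversibleChain (P n) (π n))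
    (hpos : ∀ᶠ n in atTop, 0 < tAve (P n) (π n) (1 / 4)) (hcut : AveCutoffWithWindow P π w) :
    ContCutoffWithWindow P π (fun n => max (w n) √(tCont (P n) (π n) (1 / 4))) := by
  constructor
  · obtain ⟨M, hM, hMT⟩ := exists_const_tAve_le (ε := 1 / 4) (by norm_num)
    have hO : (fun n => (tAve (P n) (π n) (1 / 4) : ℝ)) =O[atTop]
        (fun n => tCont (P n) (π n) (1 / 4)) := by
      refine IsBigO.of_bound M (Eventually.of_forall fun n => ?_)
      rw [Real.norm_of_nonneg (Nat.cast_nonneg _), Real.norm_of_nonneg (tCont_nonneg _ _ _)]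
      exact hMT (hchain n)
    have hw := isLittleO_iff.1 (hcut.1.trans_isBigO hO)
    have hs := isLittleO_iff.1 (hcut.sqrt_isLittleO hchain hpos)
    rw [isLittleO_iff]
    intro c hc
    filter_upwards [hw hc, hs hc] with n h1 h2
    exact (abs_max_le_max_abs_abs).trans (max_le h1 h2)
  · intro ε hε hε4
    obtain ⟨C₁, hC₁, h₁⟩ := exists_const_tCont_le_tAve_add (half_pos hε) (half_lt_self hε)
    obtain ⟨C₂, hC₂, h₂⟩ := exists_const_tAve_le_tCont_add (ε := 1 - ε / 2) (ε' := 1 - ε)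
      (by linarith) (by linarith)
    obtain ⟨C₃, hC₃, h₃⟩ := hcut.2 (ε / 2) (half_pos hε) (by linarith)
    refine ⟨C₁ + C₂ + C₃, by positivity, fun n => ?_⟩
    set T := tCont (P n) (π n) (1 / 4)
    have e1 : C₃ * w n ≤ C₃ * max (w n) √T := mul_le_mul_of_nonneg_left (le_max_left _ _) hC₃.le
    have e2 : (C₁ + C₂) * √T ≤ (C₁ + C₂) * max (w n) √T :=
      mul_le_mul_of_nonneg_left (le_max_right _ _) (by positivity)
    linarith [(h₁ (hchain n)).2, h₂ (hchain n), h₃ n]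

end Cutoff

theorem theorem3 {Ω : ℕ → Type*} [∀ n, Fintype (Ω n)] [∀ n, DecidableEq (Ω n)]
    (P : ∀ n, Matrix (Ω n) (Ω n) ℝ) (π : ∀ n, Ω n → ℝ)
    (hchain : ∀ n, IsReversibleChain (P n) (π n)) (w : ℕ → ℝ) :
    (ContCutoffWithWindow P π w → AveCutoffWithWindow P π w) ∧
    ((∀ᶠ n in atTop, 0 < tAve (P n) (π n) (1 / 4)) → AveCutoffWithWindow P π w →
      ContCutoffWithWindow P π (fun n => max (w n) √(tCont (P n) (π n) (1 / 4)))) :=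
  ⟨fun h => h.aveCutoffWithWindow hchain, fun hpos h => h.contCutoffWithWindow hchain hpos⟩
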